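/- Theorem (Reverse $(f,\Gamma)$-GAN Concentration Inequalities). Setting. Let $0\le a<1<b\le\infty$ and let $f:(a,b)\to\mathbb{R}$ be convex with $f(1)=0$ and strictly convex in a neighborhood of $1$. Let $f^*(z)=\sup_{t\in(a,b)}\{zt-f(t)\}\in(-\infty,\infty]$ be its Legendre transform, let $(\cdot)'_+$ denote the right derivative, and put $z_0=f'_+(1)$. Let $\alpha<\beta$ be real numbers such that $z_0+\beta-\alpha$ lies in the interior of $\{f^*<\infty\}$. For probability measures $Q,P$, a bounded measurable function $h$, and a nonempty set $\Gamma$ of such functions, define $$\Lambda_f^P[h]=\inf_{\nu\in\mathbb{R}}\{\nu+E_P[f^*(h-\nu)]\},\qquad D_f^\Gamma(Q\|P)=\sup_{h\in\Gamma}\{E_Q[h]-\Lambda_f^P[h]\}.$$ Let $\mathcal{X}$ be a topological space with its Borel $\sigma$-algebra and let $\widetilde\Gamma\subset\Gamma$ be nonempty sets of continuous functions on $\mathcal X$ with $\alpha\le h\le\beta$ for all $h\in\Gamma$. Assume that there are countable sets $\Gamma_0\subset\Gamma$ and $\widetilde\Gamma_0\subset\widetilde\Gamma$ such that every element of $\Gamma$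 (resp. $\widetilde\Gamma$) is the pointwise limit of a sequence in $\Gamma_0$ (resp. $\widetilde\Gamma_0$). Let $\mathcal{Z}$ be a measurable space, $P_Z$ a probability measure on $\mathcal Z$, $\Theta$ a separable metric space, and $\Phi_\theta:\mathcal Z\to\mathcal X$, $\theta\in\Theta$, measurable maps such that $\theta\mapsto\Phi_\theta(z)$ is continuous for every $z\in\mathcal Z$. Let $P_\theta=(\Phi_\theta)_\#P_Z$, and write $\widetilde\Gamma\circ\Phi=\{h\circ\Phi_\theta:h\in\widetilde\Gamma,\theta\in\Theta\}$. Let $Q$ be a probability measure on $\mathcal X$, let $n,m\ge1$, and let $X_1,\dots,X_n,Z_1,\dots,Z_m$ be independent random variables on a probability space $(\Omega,\mathbb{P})$ with $X_i\sim Q$ and $Z_j\sim P_Z$. Let $Q_n$ and $P_{\theta,m}$ be the empirical measures of $(X_i)_{i\le n}$ and $(\Phi_\theta(Z_j))_{j\le m}$. Let $\epsilon_{opt}^{n,m}\ge0$ and let $\theta^*_{n,m}$ be a $\Theta$-valued random variable such that, $\mathbb{P}$-almost surely, $$D_f^{\widetilde\Gamma}(P_{\theta^*_{n,m},m}\|Q_n)\le\inf_{\theta\in\Theta}D_f^{\widetilde\Gamma}(P_{\theta,m}\|Q_n)+\epsilon_{opt}^{n,m}.$$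 Quantities. For a nonempty family $\Psi$ of real functions on $\mathcal Y$, a probability measure $P$ on $\mathcal Y$ and $k\ge1$, let $\mathcal{R}_{\Psi,P,k}=E_{y\sim P^k}E_\sigma\left[\sup_{\psi\in\Psi}\frac1k\sum_{i=1}^k\sigma_i\psi(y_i)\right]$ with $\sigma_i$ independent and uniform on $\{-1,1\}$. Put $$\epsilon_{approx}^{\Gamma,\widetilde\Gamma}=\left(1+(f^*)'_+(z_0+\beta-\alpha)\right)\sup_{h\in\Gamma}\inf_{\tilde h\in\widetilde\Gamma}\|h-\tilde h\|_\infty,$$ $$\Delta_{f,n}=\inf_{z\in[z_0-(\beta-\alpha),z_0]}n\left(-z+\tfrac{n-1}{n}f^*(z)+\tfrac1nf^*(\beta-\alpha+z)\right).$$ Let $L\ge0$. If $(f^*)'_+$ is $L$-Lipschitz on $[z_0-(\beta-\alpha),z_0+\beta-\alpha]$ and $\Psi$ contains a constant function, let $$\mathcal K_{f,\Psi,P,k}=\min\left\{(1+2(\beta-\alpha)L)\mathcal R_{\Psi,P,k}+\frac{(\beta-\alpha)^2L}{2k^{1/2}},\ (f^*)'_+(\beta-\alpha+z_0)\left(\mathcal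 R_{\Psi,P,k}+\frac{\beta-\alpha}{2k^{1/2}}\right)\right\};$$ otherwise let $\mathcal K_{f,\Psi,P,k}=(f^*)'_+(\beta-\alpha+z_0)\left(\mathcal R_{\Psi,P,k}+\frac{\beta-\alpha}{2k^{1/2}}\right)$. Conclusion. For every $\epsilon>0$, $$\mathbb{P}\left(D_f^\Gamma(P_{\theta^*_{n,m}}\|Q)-\inf_{\theta\in\Theta}D_f^\Gamma(P_\theta\|Q)\ge\epsilon+\epsilon_{approx}^{\Gamma,\widetilde\Gamma}+\epsilon_{opt}^{n,m}+4\mathcal R_{\widetilde\Gamma\circ\Phi,P_Z,m}+4\mathcal K_{f,\widetilde\Gamma,Q,n}\right)\le\exp\left(-\frac{\epsilon^2}{\frac2m(\beta-\alpha)^2+\frac2n\Delta_{f,n}^2}\right).$$ If, in addition, $\inf_{\theta\in\Theta}D_f^{\widetilde\Gamma}(P_\theta\|\mu_n)=0$ for every empirical distribution $\mu_n=\frac1n\sum_{i=1}^n\delta_{x_i}$ with $x_1,\dots,x_n\in\mathcal X$, then $$\mathbb{P}\left(D_f^\Gamma(P_{\theta^*_{n,m}}\|Q)\ge\epsilon+\epsilon_{approx}^{\Gamma,\widetilde\Gamma}+\epsilon_{opt}^{n,m}+4\mathcal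 R_{\widetilde\Gamma\circ\Phi,P_Z,m}+2\mathcal K_{f,\widetilde\Gamma,Q,n}\right)\le\exp\left(-\frac{\epsilon^2}{\frac2m(\beta-\alpha)^2+\frac1{2n}\Delta_{f,n}^2}\right).$$ -/

import Mathlib

open MeasureTheory ProbabilityTheory Set Filter Topology
open scoped NNReal ENNReal

namespace FGammaGAN

noncomputable section

/-- The open interval `(a, b)` of reals, where `b` may be `+∞`. -/
def interval (a : ℝ) (b : EReal) : Set ℝ := {t : ℝ | a < t ∧ (t : EReal) < b}

/-- The class of convex functions `f : (a, b) → ℝ` with `0 ≤ a < 1 < b ≤ ∞` and `f 1 = 0`.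
Values of `f` outside `(a, b)` are never used. -/
structure IsF1 (a : ℝ) (b : EReal) (f : ℝ → ℝ) : Prop where
  nonneg : 0 ≤ a
  lt_one : a < 1
  one_lt : 1 < b
  convex : ConvexOn ℝ (interval a b) f
  map_one : f 1 = 0

/-- The Legendre transform `f^*(z) = sup_{t ∈ (a, b)} (z t - f t)`, with values in `(-∞, ∞]`. -/
def legendre (a : ℝ) (b : EReal) (f : ℝ → ℝ) (z : ℝ) : EReal :=
  ⨆ t ∈ interval a b, ((z * t - f t : ℝ) : EReal)

/-- The right derivative of a real function. -/
def rightDeriv (g : ℝ → ℝ) (x : ℝ) : ℝ := derivWithin g (Ioi x) x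

/-- The right derivative `(f^*)'_+`, meaningful on the interior of `{f^* < ∞}`. -/
def legendreRightDeriv (a : ℝ) (b : EReal) (f : ℝ → ℝ) (z : ℝ) : ℝ :=
  rightDeriv (fun y => (legendre a b f y).toReal) z

/-- The number `z₀ = f'_+(1)`. -/
def zZero (f : ℝ → ℝ) : ℝ := rightDeriv f 1

/-- The expectation of an extended-real function: integral of the positive part minus integral of
the negative part. -/
def eExpect {X : Type*} [MeasurableSpace X] (P : Measure X) (g : X → EReal) : EReal :=
  ((∫⁻ x, (g x).toENNReal ∂P : ℝ≥0∞) : EReal) - ((∫⁻ x, (-g x).toENNReal ∂P : ℝ≥0∞) : EReal)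

/-- The generalized cumulant generating function
`Λ_f^P[h] = inf_{ν ∈ ℝ} (ν + E_P[f^*(h - ν)])`. -/
def cumulant {X : Type*} [MeasurableSpace X] (a : ℝ) (b : EReal) (f : ℝ → ℝ) (P : Measure X)
    (h : X → ℝ) : EReal :=
  ⨅ ν : ℝ, (ν : EReal) + eExpect P (fun x => legendre a b f (h x - ν))

/-- The divergence `D_f^Γ(Q ‖ P) = sup_{h ∈ Γ} (E_Q[h] - Λ_f^P[h])`. -/
def divergence {X : Type*} [MeasurableSpace X] (a : ℝ) (b : EReal) (f : ℝ → ℝ)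
    (Γ : Set (X → ℝ)) (Q P : Measure X) : EReal :=
  ⨆ h ∈ Γ, ((∫ x, h x ∂Q : ℝ) : EReal) - cumulant a b f P h

/-- The empirical measure `(1/n) ∑ δ_{x_i}`. -/
def empirical {X : Type*} [MeasurableSpace X] {n : ℕ} (x : Fin n → X) : Measure X :=
  (n : ℝ≥0∞)⁻¹ • ∑ i, Measure.dirac (x i)

/-- There is a countable subset of `Γ` from which each element of `Γ` is obtained as the pointwise
limit of a sequence. -/
def PointwiseSeparable {X : Type*} (Γ : Set (X → ℝ)) : Prop :=
  ∃ Γ₀ ⊆ Γ, Γ₀.Countable ∧ ∀ h ∈ Γ, ∃ u : ℕ → X → ℝ,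
    (∀ j, u j ∈ Γ₀) ∧ ∀ x, Tendsto (fun j => u j x) atTop (𝓝 (h x))

/-- The family `{h ∘ Φ_θ : h ∈ Γ, θ ∈ Θ}`. -/
def compFamily {X Z Θ : Type*} (Γ : Set (X → ℝ)) (Φ : Θ → Z → X) : Set (Z → ℝ) :=
  {g | ∃ h ∈ Γ, ∃ θ, g = h ∘ Φ θ}

/-- The empirical Rademacher complexity (without absolute value) at `y`; the expectation over
the `n` independent uniform signs is the average over all `2 ^ n` sign vectors. -/
def empRademacher {Y : Type*} (Ψ : Set (Y → ℝ)) {n : ℕ} (y : Fin n → Y) : ℝ :=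
  ((2 : ℝ) ^ n)⁻¹ * ∑ σ : Fin n → ℤˣ,
    ⨆ ψ : Ψ, (1 / (n : ℝ)) * ∑ i, (((σ i : ℤˣ) : ℤ) : ℝ) * (ψ : Y → ℝ) (y i)

/-- The Rademacher complexity of `Ψ` relative to `P` and the sample size `n`. -/
def rademacher {Y : Type*} [MeasurableSpace Y] (Ψ : Set (Y → ℝ)) (P : Measure Y) (n : ℕ) : ℝ :=
  ∫ y, empRademacher Ψ y ∂(Measure.pi fun _ : Fin n => P)

/-- The discriminator approximation error
`(1 + (f^*)'_+(z₀ + β - α)) sup_{h ∈ Γ} inf_{h' ∈ Γ'} ‖h - h'‖_∞`. -/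
def approxError {X : Type*} (a : ℝ) (b : EReal) (f : ℝ → ℝ) (α β : ℝ) (Γ Γ' : Set (X → ℝ)) : ℝ :=
  (1 + legendreRightDeriv a b f (zZero f + β - α)) *
    ⨆ h : Γ, ⨅ h' : Γ', ⨆ x : X, |(h : X → ℝ) x - (h' : X → ℝ) x|

/-- The quantity `Δ_{f,n}`. -/
def delta (a : ℝ) (b : EReal) (f : ℝ → ℝ) (α β : ℝ) (n : ℕ) : ℝ :=
  ⨅ z : Icc (zZero f - (β - α)) (zZero f),
    (n : ℝ) * (-(z : ℝ) + ((n : ℝ) - 1) / n * (legendre a b f z).toReal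
      + 1 / (n : ℝ) * (legendre a b f (β - α + z)).toReal)

open Classical in
/-- The quantity `K_{f,Ψ,P,n}`; `L` is the Lipschitz constant that enters its definition. -/
def kTerm {Y : Type*} [MeasurableSpace Y] (a : ℝ) (b : EReal) (f : ℝ → ℝ) (α β : ℝ) (L : ℝ≥0)
    (Ψ : Set (Y → ℝ)) (P : Measure Y) (n : ℕ) : ℝ :=
  if LipschitzOnWith L (legendreRightDeriv a b f)
        (Icc (zZero f - (β - α)) (zZero f + β - α)) ∧ ∃ c : ℝ, (fun _ => c) ∈ Ψ then
    min ((1 + 2 * (β - α) * L) * rademacher Ψ P n + (β - α) ^ 2 * L / (2 * √(n : ℝ)))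
      (legendreRightDeriv a b f (β - α + zZero f) *
        (rademacher Ψ P n + (β - α) / (2 * √(n : ℝ))))
  else
    legendreRightDeriv a b f (β - α + zZero f) *
      (rademacher Ψ P n + (β - α) / (2 * √(n : ℝ)))

end

end FGammaGAN

open FGammaGAN

namespace FGammaGAN

/-! ### Convexity and the Legendre transform -/

/-! Write F for f^*, and Γ' for the smaller class Γ̃. Let S₁, S₂ be the two one-sided uniform
deviations, over h ∈ Γ' and θ ∈ Θ, between the mean of h ∘ Φ_θ under P_Z and its sample mean. Let
T₁, T₂ be the two one-sided uniform deviations, over h ∈ Γ', between the cumulants of h under Q_n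
and under Q. Almost surely, for every θ, D^Γ(P_θ*‖Q) ≤ D^Γ'(P_θ*‖Q) + approx ≤ D^Γ'(P_θ*,m‖Q_n) + S₁
+ T₁ + approx ≤ D^Γ'(P_θ,m‖Q_n) + opt + S₁ + T₁ + approx ≤ D^Γ'(P_θ‖Q_n) + S₂ + opt + S₁ + T₁ +
approx, and D^Γ'(P_θ‖Q_n) ≤ D^Γ'(P_θ‖Q) + T₂ ≤ D^Γ(P_θ‖Q) + T₂. The first claim uses the whole
chain. In the second claim the chain stops at D^Γ'(P_θ‖Q_n), whose infimum over θ is 0, so T₂ is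
absent; this accounts for 2K instead of 4K and for the smaller variance term.

It remains to concentrate T₁ + T₂ (or T₁) and S₁ + S₂, which rests on three facts.

Localization (`IsF1.cumulant_eq`): z₀ is a fixed point of F, with slopes at least 1 to its right and
at most 1 to its left. Hence the shift ν may be restricted to [α - z₀, β - z₀], and F is only
evaluated within distance β - α of z₀, where it is finite and Lipschitz.

Bounded differences (`IsConjugate.cumul_empirical_sub_le`): (u, p) ↦ F (u - p) is submodular, and
this bounds by Δ/n the effect of one sample point on the empirical cumulant. McDiarmid's inequality,
kept as a moment generating function bound, applies to the X-part and the Z-part separately;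
independence multiplies the two bounds and Chernoff's method concludes.

Expectations (`IsConjugate.integral_ciSup_cumul_sub_le`): symmetrization, followed by the
contraction principle for F - e·id. The choices e = 0 and e = 1 give the two alternatives in K.

Suprema are taken over countable subfamilies, so that they are measurable. The random θ* raises no
measurability question, since its event is almost surely contained in one that involves only S and
T. -/

theorem _root_.ConvexOn.add_rightDeriv_mul_le {S : Set ℝ} {g : ℝ → ℝ} (hg : ConvexOn ℝ S g)
    {x y : ℝ} (hx : x ∈ interior S) (hy : y ∈ S) :
    g x + derivWithin g (Ioi x) x * (y - x) ≤ g y := by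
  rcases lt_trichotomy x y with h | rfl | h
  · have := hg.rightDeriv_le_slope_of_mem_interior hx hy h
    rw [slope_def_field, le_div_iff₀ (by linarith)] at this
    linarith
  · simp
  · have h1 := hg.slope_le_leftDeriv_of_mem_interior hy hx h
    have h2 := h1.trans (hg.leftDeriv_le_rightDeriv_of_mem_interior hx)
    rw [slope_def_field, div_le_iff₀ (by linarith)] at h2
    linarith

theorem isOpen_interval (a : ℝ) (b : EReal) : IsOpen (interval a b) :=
  isOpen_Ioi.inter (isOpen_Iio.preimage continuous_coe_real_ereal)

section Legendre

variable {a : ℝ} {b : EReal} {f : ℝ → ℝ}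

theorem IsF1.one_mem (hf : IsF1 a b f) : (1 : ℝ) ∈ interval a b :=
  ⟨hf.lt_one, by simpa using hf.one_lt⟩

theorem IsF1.zZero_mul_le (hf : IsF1 a b f) {t : ℝ} (ht : t ∈ interval a b) :
    zZero f * (t - 1) ≤ f t := by
  have h := hf.convex.add_rightDeriv_mul_le
    (by rw [(isOpen_interval a b).interior_eq]; exact hf.one_mem) ht
  rw [hf.map_one, zero_add] at h
  exact h

theorem le_legendre {z t : ℝ} (ht : t ∈ interval a b) :
    ((z * t - f t : ℝ) : EReal) ≤ legendre a b f z :=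
  le_iSup₂_of_le t ht le_rfl

theorem legendre_le_iff {z : ℝ} {c : EReal} :
    legendre a b f z ≤ c ↔ ∀ t ∈ interval a b, ((z * t - f t : ℝ) : EReal) ≤ c :=
  iSup₂_le_iff

theorem IsF1.coe_le_legendre (hf : IsF1 a b f) (z : ℝ) : (z : EReal) ≤ legendre a b f z := by
  simpa [hf.map_one] using le_legendre (f := f) (z := z) hf.one_mem

theorem IsF1.legendre_mono (hf : IsF1 a b f) : Monotone (legendre a b f) := by
  intro y z hyz
  refine legendre_le_iff.2 fun t ht => le_trans ?_ (le_legendre ht)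
  have := mul_le_mul_of_nonneg_right hyz (hf.nonneg.trans ht.1.le)
  exact_mod_cast sub_le_sub_right this _

theorem IsF1.legendre_zZero (hf : IsF1 a b f) : legendre a b f (zZero f) = (zZero f : ℝ) := by
  refine le_antisymm (legendre_le_iff.2 fun t ht => ?_) (hf.coe_le_legendre _)
  have := hf.zZero_mul_le ht
  exact_mod_cast (by linarith : zZero f * t - f t ≤ zZero f)

/-- The slope is at least 1 to the right of z₀. Points t ≥ 1 gain at least s from the shift; points
t ≤ 1 contribute at most y to the supremum at y, because f lies above its tangent at 1. The argument
also covers infinite values. -/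
theorem IsF1.legendre_add_le (hf : IsF1 a b f) {y s : ℝ} (hy : zZero f ≤ y) (hs : 0 ≤ s) :
    legendre a b f y + (s : EReal) ≤ legendre a b f (y + s) := by
  rw [← EReal.le_sub_iff_add_le (by simp) (by simp)]
  refine legendre_le_iff.2 fun t ht => ?_
  rw [EReal.le_sub_iff_add_le (by simp) (by simp)]
  rcases le_total 1 t with h | h
  · refine le_trans ?_ (le_legendre ht)
    exact_mod_cast (by nlinarith : y * t - f t + s ≤ (y + s) * t - f t)
  · refine le_trans ?_ (hf.coe_le_legendre _)
    have := hf.zZero_mul_le ht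
    exact_mod_cast (by nlinarith : y * t - f t + s ≤ y + s)

/-- The mirror image: to the left of z₀ the slope is at most 1, with the roles of t ≤ 1 and t ≥ 1
exchanged. -/
theorem IsF1.legendre_le_sub_add (hf : IsF1 a b f) {y s : ℝ} (hy : y ≤ zZero f) (hs : 0 ≤ s) :
    legendre a b f y ≤ legendre a b f (y - s) + (s : EReal) := by
  refine legendre_le_iff.2 fun t ht => ?_
  rcases le_total t 1 with h | h
  · refine le_trans ?_ (add_le_add_left (le_legendre ht) _)
    exact_mod_cast (by nlinarith : y * t - f t ≤ (y - s) * t - f t + s)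
  · refine le_trans ?_ (add_le_add_left (hf.coe_le_legendre _) _)
    have := hf.zZero_mul_le ht
    exact_mod_cast (by nlinarith : y * t - f t ≤ y - s + s)

/-- The real-valued version of the Legendre transform, meaningful where the latter is finite. -/
noncomputable def conj (a : ℝ) (b : EReal) (f : ℝ → ℝ) (z : ℝ) : ℝ := (legendre a b f z).toReal

theorem IsF1.measurable_conj (hf : IsF1 a b f) : Measurable (conj a b f) :=
  hf.legendre_mono.measurable.ereal_toReal

theorem IsF1.coe_conj (hf : IsF1 a b f) {z : ℝ} (hz : legendre a b f z < ⊤) :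
    ((conj a b f z : ℝ) : EReal) = legendre a b f z :=
  EReal.coe_toReal hz.ne fun h => by simpa [h] using hf.coe_le_legendre z

theorem IsF1.conj_le_iff (hf : IsF1 a b f) {z c : ℝ} (hz : legendre a b f z < ⊤) :
    conj a b f z ≤ c ↔ ∀ t ∈ interval a b, z * t - f t ≤ c := by
  rw [← EReal.coe_le_coe_iff, hf.coe_conj hz, legendre_le_iff]
  simp only [EReal.coe_le_coe_iff]

/-- The properties of a convex conjugate `F` of an element of the class `IsF1` which is finite on
`(-∞, w]`; the point `z₀` is a fixed point at which `1` is a subgradient. -/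
structure IsConjugate (F : ℝ → ℝ) (z₀ w : ℝ) : Prop where
  measurable : Measurable F
  convex : ConvexOn ℝ (Iic w) F
  mono : MonotoneOn F (Iic w)
  self_le : ∀ z ≤ w, z ≤ F z
  map_zero : F z₀ = z₀
  lt : z₀ < w

theorem IsF1.isConjugate (hf : IsF1 a b f) {w : ℝ} (hw : legendre a b f w < ⊤)
    (hzw : zZero f < w) : IsConjugate (conj a b f) (zZero f) w := by
  have hfin : ∀ z ≤ w, legendre a b f z < ⊤ := fun z hz => (hf.legendre_mono hz).trans_lt hw
  have hge : ∀ z ≤ w, ∀ t ∈ interval a b, z * t - f t ≤ conj a b f z := fun z hz =>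
    (hf.conj_le_iff (hfin z hz)).1 le_rfl
  refine ⟨hf.measurable_conj, ⟨convex_Iic w, ?_⟩, ?_, ?_, ?_, hzw⟩
  · intro x hx y hy p q hp hq hpq
    have hxy := convex_Iic w hx hy hp hq hpq
    rw [hf.conj_le_iff (hfin _ hxy)]
    intro t ht
    have h1 := mul_le_mul_of_nonneg_left (hge x hx t ht) hp
    have h2 := mul_le_mul_of_nonneg_left (hge y hy t ht) hq
    simp only [smul_eq_mul]
    have h3 : f t = p * f t + q * f t := by rw [← add_mul, hpq, one_mul]
    linarith
  · intro x hx y hy hxy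
    rw [← EReal.coe_le_coe_iff, hf.coe_conj (hfin x hx), hf.coe_conj (hfin y hy)]
    exact hf.legendre_mono hxy
  · intro z hz
    rw [← EReal.coe_le_coe_iff, hf.coe_conj (hfin z hz)]
    exact hf.coe_le_legendre z
  · simp [conj, hf.legendre_zZero]

end Legendre

/-! ### Slopes and Lipschitz constants of the conjugate -/

namespace IsConjugate

variable {F : ℝ → ℝ} {z₀ w : ℝ}

theorem rightDeriv_mul_le (hF : IsConjugate F z₀ w) {x y : ℝ} (hx : x < w) (hy : y ≤ w) :
    F x + rightDeriv F x * (y - x) ≤ F y :=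
  hF.convex.add_rightDeriv_mul_le (by rw [interior_Iic]; exact hx) hy

/-- The chord from z₀ to x has slope at least 1, since F z₀ = z₀ and F x ≥ x, and by convexity the
right derivative at x is no smaller. -/
theorem one_le_rightDeriv (hF : IsConjugate F z₀ w) {x : ℝ} (h₀ : z₀ < x) (hx : x < w) :
    1 ≤ rightDeriv F x := by
  have h1 := hF.rightDeriv_mul_le hx hF.lt.le
  have h2 := hF.self_le x hx.le
  rw [hF.map_zero] at h1
  by_contra! h
  nlinarith

theorem rightDeriv_mono (hF : IsConjugate F z₀ w) {x y : ℝ} (hxy : x ≤ y) (hy : y < w) :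
    rightDeriv F x ≤ rightDeriv F y :=
  hF.convex.monotoneOn_rightDeriv (by rw [interior_Iic]; exact hxy.trans_lt hy)
    (by rw [interior_Iic]; exact hy) hxy

theorem abs_sub_le (hF : IsConjugate F z₀ w) {v : ℝ} (hv : v < w) {x y : ℝ}
    (hx : x ≤ v) (hy : y ≤ v) : |F x - F y| ≤ rightDeriv F v * |x - y| := by
  wlog hxy : x ≤ y generalizing x y
  · rw [abs_sub_comm, abs_sub_comm x]
    exact this hy hx (le_of_not_ge hxy)
  have h1 := hF.rightDeriv_mul_le (hy.trans_lt hv) (hx.trans hv.le)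
  have h2 := hF.rightDeriv_mono hy hv
  have h3 := hF.mono (hx.trans hv.le) (hy.trans hv.le) hxy
  rw [abs_of_nonpos (by linarith), abs_of_nonpos (by linarith)]
  nlinarith

/-- The graph of F touches the diagonal at z₀ from above, so right derivatives are at most 1 before
z₀ and at least 1 at z₀. In general z₀ may be a corner; Lipschitz continuity of the right derivative
from the left excludes this. -/
theorem rightDeriv_fixed (hF : IsConjugate F z₀ w) {c : ℝ} (hc : c < z₀) {L : ℝ≥0}
    (hL : LipschitzOnWith L (rightDeriv F) (Icc c z₀)) : rightDeriv F z₀ = 1 := by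
  apply le_antisymm
  · by_contra! h
    obtain ⟨x, hcx, hx0, hLx⟩ : ∃ x, c ≤ x ∧ x < z₀ ∧ L * (z₀ - x) < rightDeriv F z₀ - 1 := by
      have hcont : Tendsto (fun x : ℝ => (L : ℝ) * (z₀ - x)) (𝓝[<] z₀) (𝓝 (L * (z₀ - z₀))) :=
        ((continuous_const.mul (continuous_const.sub continuous_id)).tendsto z₀).mono_left
          nhdsWithin_le_nhds
      rw [sub_self, mul_zero] at hcont
      have h1 := hcont.eventually_lt_const (by linarith : (0 : ℝ) < rightDeriv F z₀ - 1)
      have h2 : ∀ᶠ x in 𝓝[<] z₀, x ∈ Ico c z₀ := Ico_mem_nhdsLT hc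
      obtain ⟨x, h1, h2⟩ := (h1.and h2).exists
      exact ⟨x, h2.1, h2.2, h1⟩
    have h1 := hL.dist_le_mul z₀ ⟨hc.le, le_rfl⟩ x ⟨hcx, hx0.le⟩
    rw [Real.dist_eq, Real.dist_eq, abs_of_pos (by linarith : 0 < z₀ - x)] at h1
    have h2 := hF.rightDeriv_mul_le (hx0.trans hF.lt) hF.lt.le
    have h3 := hF.self_le x (hx0.trans hF.lt).le
    rw [hF.map_zero] at h2
    have h4 : rightDeriv F x ≤ 1 := by
      by_contra! h
      nlinarith
    have h5 := (le_abs_self _).trans h1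
    linarith
  · have h1 := hF.rightDeriv_mul_le hF.lt le_rfl
    have h3 : ∀ y ∈ Ioo z₀ w, y - z₀ ≤ F y - F z₀ := fun y hy => by
      rw [hF.map_zero]; linarith [hF.self_le y hy.2.le]
    have h4 := hF.convex.hasDerivWithinAt_rightDeriv_of_mem_interior
      (x := z₀) (by rw [interior_Iic]; exact hF.lt)
    rw [hasDerivWithinAt_iff_tendsto_slope' self_notMem_Ioi] at h4
    refine ge_of_tendsto h4 ?_
    filter_upwards [Ioo_mem_nhdsGT hF.lt] with y hy
    rw [slope_def_field, le_div_iff₀ (by linarith [hy.1])]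
    linarith [h3 y hy]

/-- On the window the right derivative stays within L·B of its value 1 at the centre z₀. This is
what makes the e = 1 alternative in K sharper when L is small. -/
theorem abs_sub_id_sub_le (hF : IsConjugate F z₀ w) {B : ℝ} (hB : 0 < B) (hw : z₀ + B < w)
    {L : ℝ≥0} (hL : LipschitzOnWith L (rightDeriv F) (Icc (z₀ - B) (z₀ + B))) {x y : ℝ}
    (hx : x ∈ Icc (z₀ - B) (z₀ + B)) (hy : y ∈ Icc (z₀ - B) (z₀ + B)) :
    |(F x - x) - (F y - y)| ≤ L * B * |x - y| := by
  wlog hxy : x ≤ y generalizing x y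
  · rw [abs_sub_comm, abs_sub_comm x]
    exact this hy hx (le_of_not_ge hxy)
  have h0 : rightDeriv F z₀ = 1 := hF.rightDeriv_fixed (c := z₀ - B) (by linarith)
    (hL.mono (Icc_subset_Icc_right (by linarith)))
  have key : ∀ u ∈ Icc (z₀ - B) (z₀ + B), |rightDeriv F u - 1| ≤ L * B := by
    intro u hu
    have := hL.dist_le_mul u hu z₀ ⟨by linarith, by linarith⟩
    rw [Real.dist_eq, Real.dist_eq, h0] at this
    refine this.trans (mul_le_mul_of_nonneg_left ?_ L.2)
    rw [abs_le]; constructor <;> linarith [hu.1, hu.2]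
  have h1 := hF.rightDeriv_mul_le (hx.2.trans_lt hw) (hy.2.trans hw.le)
  have h2 := hF.rightDeriv_mul_le (hy.2.trans_lt hw) (hx.2.trans hw.le)
  have hx1 := (abs_le.1 (key x hx)).1
  have hy1 := (abs_le.1 (key y hy)).2
  rw [abs_of_nonpos (by linarith : x - y ≤ 0), abs_le]
  constructor <;> nlinarith

end IsConjugate

/-! ### The generalized cumulant generating function -/

/-- Makes the infimum over shifts countable, for measurability in the sample and for symmetrization.
-/
theorem ciInf_denseSeq {T : Type*} [TopologicalSpace T] [TopologicalSpace.SeparableSpace T]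
    [Nonempty T] {g : T → ℝ} (hg : Continuous g) (hb : BddBelow (range g)) :
    ⨅ t, g t = ⨅ k, g (TopologicalSpace.denseSeq T k) := by
  apply le_antisymm
  · exact le_ciInf fun k => ciInf_le hb _
  · refine le_ciInf fun t => ?_
    have hb' : BddBelow (range fun k => g (TopologicalSpace.denseSeq T k)) :=
      hb.mono (by rintro _ ⟨k, rfl⟩; exact ⟨_, rfl⟩)
    have hcl : IsClosed {t | ⨅ k, g (TopologicalSpace.denseSeq T k) ≤ g t} :=
      isClosed_le continuous_const hg
    have := hcl.closure_subset_iff.2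
      (show range (TopologicalSpace.denseSeq T) ⊆ _ by rintro _ ⟨k, rfl⟩; exact ciInf_le hb' k)
    exact this (by rw [(TopologicalSpace.denseRange_denseSeq T).closure_range]; trivial)

/-! ### Empirical measures and extended-real expectations -/

theorem isProbabilityMeasure_empirical {X : Type*} [MeasurableSpace X] {n : ℕ} (hn : 0 < n)
    (x : Fin n → X) : IsProbabilityMeasure (empirical x) := by
  constructor
  have : (n : ℝ≥0∞) ≠ 0 := by exact_mod_cast hn.ne'
  simp [empirical, ENNReal.inv_mul_cancel this (by simp)]

theorem integral_empirical {X : Type*} [MeasurableSpace X] {n : ℕ} (x : Fin n → X)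
    {h : X → ℝ} (hh : Measurable h) :
    ∫ y, h y ∂(empirical x) = (1 / (n : ℝ)) * ∑ i, h (x i) := by
  rw [empirical, integral_smul_measure, integral_finsetSum_measure]
  · simp [integral_dirac' _ _ hh.stronglyMeasurable]
  · intro i _
    exact (integrable_dirac' hh.stronglyMeasurable (by simp))

section eExpect

variable {X : Type*} [MeasurableSpace X] {P : Measure X}

theorem eExpect_mono {g₁ g₂ : X → EReal} (h : ∀ x, g₁ x ≤ g₂ x) :
    eExpect P g₁ ≤ eExpect P g₂ := by
  unfold eExpect
  refine EReal.sub_le_sub ?_ ?_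
  · exact_mod_cast lintegral_mono fun x => EReal.toENNReal_le_toENNReal (h x)
  · exact_mod_cast lintegral_mono fun x =>
      EReal.toENNReal_le_toENNReal (EReal.neg_le_neg_iff.2 (h x))

theorem eExpect_coe {g : X → ℝ} (hg : Integrable g P) :
    eExpect P (fun x => (g x : EReal)) = ((∫ x, g x ∂P : ℝ) : EReal) := by
  have h1 : ∫⁻ x, ENNReal.ofReal (g x) ∂P ≠ ⊤ := hg.lintegral_lt_top.ne
  have h2 : ∫⁻ x, ENNReal.ofReal (-g x) ∂P ≠ ⊤ := hg.neg.lintegral_lt_top.ne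
  rw [integral_eq_lintegral_pos_part_sub_lintegral_neg_part hg, EReal.coe_sub,
    EReal.coe_ennreal_toReal h1, EReal.coe_ennreal_toReal h2]
  rfl

end eExpect

/-- The objective defining the cumulant, for a real-valued conjugate `F`. -/
noncomputable def cumulObj {X : Type*} [MeasurableSpace X] (F : ℝ → ℝ) (P : Measure X) (h : X → ℝ)
    (ν : ℝ) : ℝ := ν + ∫ x, F (h x - ν) ∂P

/-- The real-valued version of the cumulant of functions with values in `[α, β]`. -/
noncomputable def cumul {X : Type*} [MeasurableSpace X] (F : ℝ → ℝ) (z₀ α β : ℝ) (P : Measure X)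
    (h : X → ℝ) : ℝ := ⨅ ν : Icc (α - z₀) (β - z₀), cumulObj F P h ν

theorem sub_mem_Icc {z₀ α β y ν : ℝ} (hy : α ≤ y ∧ y ≤ β)
    (hν : ν ∈ Icc (α - z₀) (β - z₀)) : y - ν ∈ Icc (z₀ - (β - α)) (z₀ + (β - α)) :=
  ⟨by linarith [hy.1, hν.2], by linarith [hy.2, hν.1]⟩

theorem le_integral_of_bdd {X : Type*} [MeasurableSpace X] {P : Measure X}
    [IsProbabilityMeasure P] {α β : ℝ} {h : X → ℝ} (hh : Measurable h) (hb : ∀ x, α ≤ h x ∧ h x ≤ β) :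
    α ≤ ∫ x, h x ∂P ∧ ∫ x, h x ∂P ≤ β := by
  have hi : Integrable h P := Integrable.of_mem_Icc α β hh.aemeasurable (ae_of_all _ hb)
  constructor
  · simpa using integral_mono (μ := P) (integrable_const α) hi fun x => (hb x).1
  · simpa using integral_mono (μ := P) hi (integrable_const β) fun x => (hb x).2

theorem le_cumul {X : Type*} [MeasurableSpace X] {P : Measure X} {F : ℝ → ℝ} {z₀ α β : ℝ}
    {h : X → ℝ} (hαβ : α < β) {c : ℝ}
    (hc : ∀ ν ∈ Icc (α - z₀) (β - z₀), c ≤ cumulObj F P h ν) : c ≤ cumul F z₀ α β P h := by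
  have : Nonempty (Icc (α - z₀) (β - z₀)) := ⟨⟨α - z₀, by simp [hαβ.le]⟩⟩
  exact le_ciInf fun ν => hc ν ν.2

theorem IsConjugate.cumulObj_empirical {X : Type*} [MeasurableSpace X] {F : ℝ → ℝ} {z₀ w : ℝ}
    (hF : IsConjugate F z₀ w) {h : X → ℝ} (hh : Measurable h) {n : ℕ} (x : Fin n → X) (ν : ℝ) :
    cumulObj F (empirical x) h ν = ν + (1 / (n : ℝ)) * ∑ j, F (h (x j) - ν) :=
  congrArg (ν + ·) (integral_empirical x (hF.measurable.comp (hh.sub_const ν)))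

/-! ### Bounds, continuity and bounded differences of the localized cumulant -/

namespace IsConjugate

variable {X : Type*} [MeasurableSpace X] {P : Measure X} [IsProbabilityMeasure P]
  {F : ℝ → ℝ} {z₀ w α β ν : ℝ} {h h' : X → ℝ}

theorem mem_Icc (hF : IsConjugate F z₀ w) (hw : z₀ + (β - α) < w) {z : ℝ}
    (hz : z ∈ Icc (z₀ - (β - α)) (z₀ + (β - α))) :
    F z ∈ Icc (F (z₀ - (β - α))) (F (z₀ + (β - α))) :=
  ⟨hF.mono (hz.1.trans (hz.2.trans hw.le)) (hz.2.trans hw.le) hz.1,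
    hF.mono (hz.2.trans hw.le) hw.le hz.2⟩

theorem integrable_sub (hF : IsConjugate F z₀ w) (hw : z₀ + (β - α) < w) (hh : Measurable h)
    (hb : ∀ x, α ≤ h x ∧ h x ≤ β) (hν : ν ∈ Icc (α - z₀) (β - z₀)) :
    Integrable (fun x => F (h x - ν)) P :=
  Integrable.of_mem_Icc _ _ (hF.measurable.comp (hh.sub_const ν)).aemeasurable
    (ae_of_all _ fun x => hF.mem_Icc hw (sub_mem_Icc (hb x) hν))

theorem integral_le_cumulObj (hF : IsConjugate F z₀ w) (hw : z₀ + (β - α) < w)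
    (hh : Measurable h) (hb : ∀ x, α ≤ h x ∧ h x ≤ β) (hν : ν ∈ Icc (α - z₀) (β - z₀)) :
    ∫ x, h x ∂P ≤ cumulObj F P h ν := by
  have hi : Integrable h P := Integrable.of_mem_Icc α β hh.aemeasurable (ae_of_all _ hb)
  have : ∫ x, (h x - ν) ∂P ≤ ∫ x, F (h x - ν) ∂P :=
    integral_mono (hi.sub (integrable_const ν)) (hF.integrable_sub hw hh hb hν)
      fun x => hF.self_le _ ((sub_mem_Icc (hb x) hν).2.trans hw.le)
  rw [integral_sub hi (integrable_const ν)] at this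
  simp only [integral_const, probReal_univ, one_smul] at this
  unfold cumulObj
  linarith

theorem bddBelow_cumulObj (hF : IsConjugate F z₀ w) (hw : z₀ + (β - α) < w)
    (hh : Measurable h) (hb : ∀ x, α ≤ h x ∧ h x ≤ β) :
    BddBelow (range fun ν : Icc (α - z₀) (β - z₀) => cumulObj F P h ν) :=
  ⟨α, by
    rintro _ ⟨ν, rfl⟩
    exact (le_integral_of_bdd hh hb).1.trans (hF.integral_le_cumulObj hw hh hb ν.2)⟩

theorem cumul_le (hF : IsConjugate F z₀ w) (hw : z₀ + (β - α) < w)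
    (hh : Measurable h) (hb : ∀ x, α ≤ h x ∧ h x ≤ β) (hν : ν ∈ Icc (α - z₀) (β - z₀)) :
    cumul F z₀ α β P h ≤ cumulObj F P h ν :=
  ciInf_le (hF.bddBelow_cumulObj hw hh hb) ⟨ν, hν⟩

theorem cumul_mem_Icc (hF : IsConjugate F z₀ w) (hαβ : α < β) (hw : z₀ + (β - α) < w)
    (hh : Measurable h) (hb : ∀ x, α ≤ h x ∧ h x ≤ β) :
    cumul F z₀ α β P h ∈ Icc α β := by
  constructor
  · exact le_cumul hαβ fun ν hν =>
      (le_integral_of_bdd hh hb).1.trans (hF.integral_le_cumulObj hw hh hb hν)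
  -- The shift β - z₀ puts every argument of F to the left of z₀, where F ≤ z₀ by monotonicity.
  · have hν : β - z₀ ∈ Icc (α - z₀) (β - z₀) := by simp [hαβ.le]
    refine (hF.cumul_le hw hh hb hν).trans ?_
    have : ∫ x, F (h x - (β - z₀)) ∂P ≤ ∫ _, z₀ ∂P := by
      refine integral_mono (hF.integrable_sub hw hh hb hν) (integrable_const _) fun x => ?_
      conv_rhs => rw [← hF.map_zero]
      exact hF.mono (show _ ≤ w by linarith [(hb x).2, hF.lt]) hF.lt.le (by linarith [(hb x).2])
    simp only [integral_const, probReal_univ, one_smul] at this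
    unfold cumulObj
    linarith

/-- For each fixed shift the objective is Lipschitz in h for the L¹ distance, with constant the
right derivative of F at the right end of the window; an infimum inherits this. -/
theorem cumul_le_add (hF : IsConjugate F z₀ w) (hαβ : α < β) (hw : z₀ + (β - α) < w)
    (hh : Measurable h) (hb : ∀ x, α ≤ h x ∧ h x ≤ β)
    (hh' : Measurable h') (hb' : ∀ x, α ≤ h' x ∧ h' x ≤ β) :
    cumul F z₀ α β P h ≤
      cumul F z₀ α β P h' + rightDeriv F (z₀ + (β - α)) * ∫ x, |h x - h' x| ∂P := by
  rw [← sub_le_iff_le_add]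
  refine le_cumul hαβ fun ν hν => ?_
  rw [sub_le_iff_le_add]
  refine (hF.cumul_le hw hh hb hν).trans ?_
  have hi : Integrable h P := Integrable.of_mem_Icc α β hh.aemeasurable (ae_of_all _ hb)
  have hi' : Integrable h' P := Integrable.of_mem_Icc α β hh'.aemeasurable (ae_of_all _ hb')
  unfold cumulObj
  have hd : Integrable (fun x => rightDeriv F (z₀ + (β - α)) * |h x - h' x|) P :=
    (hi.sub hi').abs.const_mul _
  rw [add_assoc, ← integral_const_mul, ← integral_add (hF.integrable_sub hw hh' hb' hν) hd]
  refine add_le_add_right (integral_mono (hF.integrable_sub hw hh hb hν)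
    ((hF.integrable_sub hw hh' hb' hν).add hd) fun x => ?_) _
  have h1 := hF.abs_sub_le hw (sub_mem_Icc (hb x) hν).2 (sub_mem_Icc (hb' x) hν).2
  rw [sub_sub_sub_cancel_right] at h1
  have h2 := le_abs_self (F (h x - ν) - F (h' x - ν))
  simp only [Pi.add_apply]
  linarith

theorem abs_cumul_sub_le (hF : IsConjugate F z₀ w) (hαβ : α < β) (hw : z₀ + (β - α) < w)
    (hh : Measurable h) (hb : ∀ x, α ≤ h x ∧ h x ≤ β)
    (hh' : Measurable h') (hb' : ∀ x, α ≤ h' x ∧ h' x ≤ β) :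
    |cumul F z₀ α β P h - cumul F z₀ α β P h'| ≤
      rightDeriv F (z₀ + (β - α)) * ∫ x, |h x - h' x| ∂P := by
  have h1 := hF.cumul_le_add (P := P) hαβ hw hh hb hh' hb'
  have h2 := hF.cumul_le_add (P := P) hαβ hw hh' hb' hh hb
  simp_rw [abs_sub_comm (h' _)] at h2
  rw [abs_le]
  constructor <;> linarith

theorem continuous_cumulObj (hF : IsConjugate F z₀ w) (hw : z₀ + (β - α) < w)
    (hh : Measurable h) (hb : ∀ x, α ≤ h x ∧ h x ≤ β) :
    Continuous fun ν : Icc (α - z₀) (β - z₀) => cumulObj F P h ν := by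
  refine continuous_subtype_val.add ?_
  refine continuous_of_dominated (bound := fun _ => max |F (z₀ - (β - α))| |F (z₀ + (β - α))|)
    (fun ν => (hF.integrable_sub hw hh hb ν.2).aestronglyMeasurable) ?_
    (integrable_const _) ?_
  · intro ν
    refine ae_of_all _ fun x => ?_
    have := hF.mem_Icc hw (sub_mem_Icc (hb x) ν.2)
    exact abs_le_max_abs_abs this.1 this.2
  · refine ae_of_all _ fun x => ?_
    have hc : ContinuousOn F (Iio w) := by
      have := hF.convex.continuousOn_interior
      rwa [interior_Iic] at this
    refine hc.comp_continuous (by fun_prop) fun ν => ?_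
    exact (sub_mem_Icc (hb x) ν.2).2.trans_lt hw

/-- A convex function increases the sum of its values at two points when they are spread out. -/
theorem add_le_add_of_spread (hF : IsConjugate F z₀ w) {s t x y : ℝ} (ht : t ≤ w) (hsx : s ≤ x)
    (hxt : x ≤ t) (hxy : x + y = s + t) : F x + F y ≤ F s + F t := by
  rcases eq_or_lt_of_le (hsx.trans hxt) with h | h
  · obtain rfl : x = s := le_antisymm (h ▸ hxt) hsx
    obtain rfl : y = t := by linarith
    rfl
  have hne : t - s ≠ 0 := (sub_pos.2 h).ne'
  -- Barycentric weights of x with respect to s and t. Because x + y = s + t, the same weights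
  -- swapped represent y, and the two convexity inequalities add up.
  have hp : 0 ≤ (t - x) / (t - s) := div_nonneg (by linarith) (by linarith)
  have hq : 0 ≤ (x - s) / (t - s) := div_nonneg (by linarith) (by linarith)
  have hpq : (t - x) / (t - s) + (x - s) / (t - s) = 1 := by field_simp; ring
  have h1 := hF.convex.2 (show s ≤ w by linarith) (show t ≤ w from ht) hp hq hpq
  have h2 := hF.convex.2 (show s ≤ w by linarith) (show t ≤ w from ht) hq hp
    (by rw [add_comm]; exact hpq)
  have e1 : ((t - x) / (t - s)) • s + ((x - s) / (t - s)) • t = x := by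
    simp only [smul_eq_mul]; field_simp; ring
  have e2 : ((x - s) / (t - s)) • s + ((t - x) / (t - s)) • t = y := by
    obtain rfl : y = s + t - x := by linarith
    simp only [smul_eq_mul]; field_simp; ring
  rw [e1] at h1
  rw [e2] at h2
  simp only [smul_eq_mul] at h1 h2
  calc F x + F y ≤ ((t - x) / (t - s) + (x - s) / (t - s)) * (F s + F t) := by linarith
    _ = _ := by rw [hpq, one_mul]

/-- If the pairs (u, v) and (p, q) are ordered alike, both sides have the same terms. If they are
ordered oppositely, the arguments on the left lie between those on the right and have the same sum,
so convexity decides. -/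
theorem submodular (hF : IsConjugate F z₀ w) {u v p q : ℝ} (hu : u - p ≤ w) (hv : v - q ≤ w) :
    F (max u v - max p q) + F (min u v - min p q) ≤ F (u - p) + F (v - q) := by
  rcases le_total u v with h | h <;> rcases le_total p q with h' | h' <;>
    simp only [max_eq_left, max_eq_right, min_eq_left, min_eq_right, h, h']
  · exact (add_comm _ _).le
  · refine hF.add_le_add_of_spread hv ?_ ?_ ?_ <;> linarith
  · rw [add_comm (F (u - p))]
    refine hF.add_le_add_of_spread hu ?_ ?_ ?_ <;> linarith
  · rfl

/-- Compares an arbitrary shift q for x' with the shift max p q for x, where p = α - z is free.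
Submodularity trades the pair (q, p) for (max p q, min p q), and the cost of the trade is the
objective at p of the worst vector, equal to β at the changed coordinate and α elsewhere. Minimizing
over z gives Δ/n. -/
theorem cumul_empirical_sub_le (hF : IsConjugate F z₀ w) (hαβ : α < β) (hw : z₀ + (β - α) < w)
    (hh : Measurable h) (hb : ∀ x, α ≤ h x ∧ h x ≤ β) {n : ℕ} (hn : 0 < n) {x x' : Fin n → X}
    {i : Fin n} (hxx' : ∀ j ≠ i, x j = x' j) {z : ℝ} (hz : z ∈ Icc (z₀ - (β - α)) z₀) :
    cumul F z₀ α β (empirical x) h - cumul F z₀ α β (empirical x') h ≤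
      -z + ((n : ℝ) - 1) / n * F z + 1 / (n : ℝ) * F (β - α + z) := by
  have := isProbabilityMeasure_empirical hn x
  have := isProbabilityMeasure_empirical hn x'
  have hn' : (0 : ℝ) < n := by exact_mod_cast hn
  rw [sub_le_comm]
  refine le_cumul hαβ fun q hq => ?_
  set p := α - z with hp_def
  have hp : p ∈ Icc (α - z₀) (β - z₀) := ⟨by linarith [hz.2], by linarith [hz.1]⟩
  have hmax : max p q ∈ Icc (α - z₀) (β - z₀) :=
    ⟨hp.1.trans (le_max_left _ _), max_le hp.2 hq.2⟩
  have hmin : min p q ∈ Icc (α - z₀) (β - z₀) :=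
    ⟨le_min hp.1 hq.1, (min_le_left _ _).trans hp.2⟩
  have h1 := hF.cumul_le (P := empirical x) hw hh hb hmax
  rw [hF.cumulObj_empirical hh] at h1 ⊢
  -- With this u, max (u j) (h (x' j)) dominates h (x j) at every j: at i because u i = β, elsewhere
  -- because x and x' agree.
  let u : Fin n → ℝ := fun j => if j = i then β else α
  have hu : ∀ j, α ≤ u j ∧ u j ≤ β := fun j => by
    by_cases hj : j = i <;> simp [u, hj, hαβ.le]
  have hterm : ∀ j, F (h (x j) - max p q) + (α - min p q) ≤ F (u j - p) + F (h (x' j) - q) := by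
    intro j
    refine le_trans ?_ (hF.submodular ((sub_mem_Icc (hu j) hp).2.trans hw.le)
      ((sub_mem_Icc (hb (x' j)) hq).2.trans hw.le))
    refine add_le_add (hF.mono ((sub_mem_Icc (hb (x j)) hmax).2.trans hw.le) ?_ ?_) ?_
    · exact (sub_mem_Icc ⟨(hu j).1.trans (le_max_left _ _), max_le (hu j).2 (hb _).2⟩
        hmax).2.trans hw.le
    · refine sub_le_sub_right ?_ _
      by_cases hj : j = i
      · exact le_max_of_le_left (by simp [u, hj, (hb _).2])
      · rw [hxx' j hj]
        exact le_max_right _ _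
    -- The term with the minima is bounded below through F z ≥ z.
    · have h3 : min (u j) (h (x' j)) - min p q ≤ w := (sub_mem_Icc
        ⟨le_min (hu j).1 (hb _).1, (min_le_left _ _).trans (hu j).2⟩ hmin).2.trans hw.le
      have h4 := hF.self_le _ h3
      have h5 : α ≤ min (u j) (h (x' j)) := le_min (hu j).1 (hb _).1
      linarith
  have hsum := Finset.sum_le_sum fun j (_ : j ∈ Finset.univ) => hterm j
  simp only [Finset.sum_add_distrib, Finset.sum_const, Finset.card_univ, Fintype.card_fin,
    nsmul_eq_mul] at hsum
  have hU : ∑ j, F (u j - p) = ((n : ℝ) - 1) * F z + F (β - α + z) := by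
    have : ∀ j, F (u j - p) = F z + if j = i then F (β - α + z) - F z else 0 := fun j => by
      by_cases hj : j = i
      · simp only [u, hj, if_true, hp_def]
        rw [show β - (α - z) = β - α + z by ring]
        ring
      · simp [u, hj, hp_def]
    simp only [this, Finset.sum_add_distrib, Finset.sum_const, Finset.card_univ, Fintype.card_fin,
      nsmul_eq_mul, Finset.sum_ite_eq', Finset.mem_univ, if_true]
    ring
  rw [hU] at hsum
  have hsum' := mul_le_mul_of_nonneg_left hsum (by positivity : 0 ≤ 1 / (n : ℝ))
  have e1 : 1 / (n : ℝ) * (∑ j, F (h (x j) - max p q) + n * (α - min p q)) =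
      1 / (n : ℝ) * ∑ j, F (h (x j) - max p q) + (α - min p q) := by field_simp
  have e2 : 1 / (n : ℝ) * (((n : ℝ) - 1) * F z + F (β - α + z) + ∑ j, F (h (x' j) - q)) =
      ((n : ℝ) - 1) / n * F z + 1 / (n : ℝ) * F (β - α + z) +
        1 / (n : ℝ) * ∑ j, F (h (x' j) - q) := by ring
  rw [e1, e2] at hsum'
  -- Turns the leftover shifts max p q + min p q - α into q - z.
  have h6 := max_add_min p q
  linarith

theorem measurable_cumul_empirical (hF : IsConjugate F z₀ w) (hαβ : α < β)
    (hw : z₀ + (β - α) < w) (hh : Measurable h) (hb : ∀ x, α ≤ h x ∧ h x ≤ β) {n : ℕ}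
    (hn : 0 < n) : Measurable fun x : Fin n → X => cumul F z₀ α β (empirical x) h := by
  have : Nonempty (Icc (α - z₀) (β - z₀)) := ⟨⟨α - z₀, by simp [hαβ.le]⟩⟩
  have : ∀ x : Fin n → X, cumul F z₀ α β (empirical x) h =
      ⨅ k, cumulObj F (empirical x) h (TopologicalSpace.denseSeq (Icc (α - z₀) (β - z₀)) k) :=
    fun x => by
      have := isProbabilityMeasure_empirical hn x
      exact ciInf_denseSeq (hF.continuous_cumulObj hw hh hb) (hF.bddBelow_cumulObj hw hh hb)
  simp_rw [this]
  refine Measurable.iInf fun k => ?_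
  simp_rw [hF.cumulObj_empirical hh]
  refine measurable_const.add (measurable_const.mul (Finset.measurable_sum _ fun j _ => ?_))
  exact hF.measurable.comp ((hh.comp (measurable_pi_apply j)).sub_const _)

end IsConjugate

/-- Moving a shift to the nearest point of [α - z₀, β - z₀] cannot increase the objective, by the
slope bounds on either side of z₀. The original shift may give infinite values, so this comparison
is made pointwise in `EReal` before integrating. -/
theorem IsF1.cumulant_eq {X : Type*} [MeasurableSpace X] {P : Measure X} [IsProbabilityMeasure P]
    {a : ℝ} {b : EReal} {f : ℝ → ℝ} (hf : IsF1 a b f) {α β w : ℝ} (hαβ : α < β)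
    (hw : zZero f + (β - α) < w) (hfin : legendre a b f w < ⊤) {h : X → ℝ} (hh : Measurable h)
    (hb : ∀ x, α ≤ h x ∧ h x ≤ β) :
    cumulant a b f P h = (cumul (conj a b f) (zZero f) α β P h : ℝ) := by
  set z₀ := zZero f
  set F := conj a b f
  have hF : IsConjugate F z₀ w := hf.isConjugate hfin (by linarith)
  have hcoe : ∀ ν ∈ Icc (α - z₀) (β - z₀), ∀ x, legendre a b f (h x - ν) = (F (h x - ν) : ℝ) :=
    fun ν hν x => (hf.coe_conj ((hf.legendre_mono
      ((sub_mem_Icc (hb x) hν).2.trans hw.le)).trans_lt hfin)).symm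
  have hup : ∀ ν ∈ Icc (α - z₀) (β - z₀), cumulant a b f P h ≤ (cumulObj F P h ν : ℝ) := by
    intro ν hν
    refine (iInf_le _ ν).trans ?_
    simp_rw [hcoe ν hν]
    rw [eExpect_coe (hF.integrable_sub hw hh hb hν), cumulObj, EReal.coe_add]
  have hlow : ((cumul F z₀ α β P h : ℝ) : EReal) ≤ cumulant a b f P h := by
    refine le_iInf fun ν => ?_
    -- ν₀ is the projection of ν onto the interval. Below it every h x - ν₀ is at least z₀, above it
    -- at most z₀.
    obtain ⟨ν₀, hν₀, hle⟩ : ∃ ν₀ ∈ Icc (α - z₀) (β - z₀), ∀ x,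
        ((F (h x - ν₀) + (ν₀ - ν) : ℝ) : EReal) ≤ legendre a b f (h x - ν) := by
      have hlo : α - z₀ ∈ Icc (α - z₀) (β - z₀) := by simp [hαβ.le]
      have hhi : β - z₀ ∈ Icc (α - z₀) (β - z₀) := by simp [hαβ.le]
      rcases lt_or_ge ν (α - z₀) with h1 | h1
      · refine ⟨α - z₀, hlo, fun x => ?_⟩
        have := hf.legendre_add_le (y := h x - (α - z₀)) (s := α - z₀ - ν)
          (by linarith [(hb x).1]) (by linarith)
        rw [hcoe _ hlo, sub_add_sub_cancel] at this
        exact_mod_cast this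
      rcases lt_or_ge (β - z₀) ν with h2 | h2
      · refine ⟨β - z₀, hhi, fun x => ?_⟩
        have := hf.legendre_le_sub_add (y := h x - (β - z₀)) (s := ν - (β - z₀))
          (by linarith [(hb x).2]) (by linarith)
        rw [hcoe _ hhi, sub_sub, add_sub_cancel, ← EReal.sub_le_iff_le_add (Or.inl (EReal.coe_ne_bot _))
          (Or.inl (EReal.coe_ne_top _)), ← EReal.coe_sub] at this
        rwa [show F (h x - (β - z₀)) + (β - z₀ - ν) = F (h x - (β - z₀)) - (ν - (β - z₀)) by ring]
      · exact ⟨ν, ⟨h1, h2⟩, fun x => by simp [hcoe ν ⟨h1, h2⟩ x]⟩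
    have hint := hF.integrable_sub (P := P) hw hh hb hν₀
    have h1 := eExpect_mono (P := P) hle
    have hint' : Integrable (fun x => F (h x - ν₀) + (ν₀ - ν)) P := hint.add (integrable_const _)
    rw [eExpect_coe hint', integral_add hint (integrable_const _)] at h1
    refine le_trans ?_ (add_le_add_right h1 _)
    have h2 := hF.cumul_le (P := P) hw hh hb hν₀
    simp only [integral_const, probReal_univ, one_smul]
    rw [← EReal.coe_add, EReal.coe_le_coe_iff]
    unfold cumulObj at h2
    linarith
  have hlo : α - z₀ ∈ Icc (α - z₀) (β - z₀) := by simp [hαβ.le]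
  have htop : cumulant a b f P h ≠ ⊤ := ((hup _ hlo).trans_lt (EReal.coe_lt_top _)).ne
  have hbot : cumulant a b f P h ≠ ⊥ := ((EReal.bot_lt_coe _).trans_le hlow).ne'
  refine le_antisymm ?_ hlow
  rw [← EReal.coe_toReal htop hbot, EReal.coe_le_coe_iff]
  refine le_cumul hαβ fun ν hν => ?_
  rw [← EReal.coe_le_coe_iff, EReal.coe_toReal htop hbot]
  exact hup ν hν

/-! ### Suprema of bounded families of reals -/

section Sup

variable {ι κ : Type*}

theorem bddAbove_range_of_abs_le {u : ι → ℝ} {C : ℝ} (h : ∀ i, |u i| ≤ C) :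
    BddAbove (range u) :=
  ⟨C, by rintro _ ⟨i, rfl⟩; exact (le_abs_self _).trans (h i)⟩

theorem abs_ciSup_le [Nonempty ι] {u : ι → ℝ} {C : ℝ} (h : ∀ i, |u i| ≤ C) : |⨆ i, u i| ≤ C := by
  obtain ⟨i⟩ := ‹Nonempty ι›
  have : Nonempty ι := ⟨i⟩
  exact abs_le.2 ⟨(abs_le.1 (h i)).1.trans (le_ciSup (bddAbove_range_of_abs_le h) i),
    ciSup_le fun j => (abs_le.1 (h j)).2⟩

theorem ciSup_le_ciSup_add [Nonempty ι] {u v : ι → ℝ} {c : ℝ} (hv : BddAbove (range v))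
    (h : ∀ i, u i ≤ v i + c) : ⨆ i, u i ≤ (⨆ i, v i) + c :=
  ciSup_le fun i => (h i).trans (add_le_add_left (le_ciSup hv i) c)

theorem integrable_of_abs_le {Y : Type*} [MeasurableSpace Y] {P : Measure Y} [IsFiniteMeasure P]
    {g : Y → ℝ} (hg : Measurable g) {C : ℝ} (hC : ∀ y, |g y| ≤ C) : Integrable g P :=
  Integrable.of_bound hg.aestronglyMeasurable C (ae_of_all _ hC)

end Sup

/-! ### Bounded differences -/

section McDiarmid

variable {Y : Type*} [MeasurableSpace Y] (P : Measure Y) [IsProbabilityMeasure P]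

theorem measurePreserving_finCons (k : ℕ) :
    MeasurePreserving (fun p : Y × (Fin k → Y) => (Fin.cons p.1 p.2 : Fin (k + 1) → Y))
      (P.prod (Measure.pi fun _ => P)) (Measure.pi fun _ => P) := by
  have h := (measurePreserving_piFinSuccAbove (fun _ : Fin (k + 1) => P) 0).symm
  convert h using 1
  funext p
  exact (Fin.insertNth_zero' p.1 p.2).symm

/-- Oscillation at most c places g in an interval of length c starting at its infimum, so
Hoeffding's lemma applies. -/
theorem integral_exp_le_of_sub_le {g : Y → ℝ} (hg : Measurable g) {c : ℝ}
    (hc : ∀ y y', g y - g y' ≤ c) (s : ℝ) :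
    ∫ y, Real.exp (s * (g y - ∫ y', g y' ∂P)) ∂P ≤ Real.exp (c ^ 2 * s ^ 2 / 8) := by
  obtain ⟨y₀⟩ : Nonempty Y := nonempty_of_isProbabilityMeasure P
  have hc0 : 0 ≤ c := by simpa using hc y₀ y₀
  have hbb : BddBelow (range g) := ⟨g y₀ - c, by rintro _ ⟨y, rfl⟩; linarith [hc y₀ y]⟩
  have : Nonempty Y := ⟨y₀⟩
  have hmem : ∀ y, g y ∈ Icc (⨅ y, g y) ((⨅ y, g y) + c) := fun y => by
    refine ⟨ciInf_le hbb y, ?_⟩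
    rw [← sub_le_iff_le_add]
    exact le_ciInf fun y' => by linarith [hc y y']
  have h := (hasSubgaussianMGF_of_mem_Icc (μ := P) hg.aemeasurable (ae_of_all _ hmem)).mgf_le s
  rw [mgf] at h
  refine h.trans (Real.exp_le_exp.2 (le_of_eq ?_))
  simp only [add_sub_cancel_left, NNReal.coe_pow, NNReal.coe_div, coe_nnnorm, Real.norm_eq_abs,
    abs_of_nonneg hc0, NNReal.coe_ofNat]
  ring

/-- **McDiarmid's inequality**, in the form of a bound on the moment generating function. -/
theorem integral_exp_le_of_bounded_differences {k : ℕ} {G : (Fin k → Y) → ℝ} (hG : Measurable G)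
    {C : ℝ} (hC : ∀ x, |G x| ≤ C) {c : ℝ}
    (hc : ∀ i x x', (∀ j ≠ i, x j = x' j) → G x - G x' ≤ c) (s : ℝ) :
    ∫ x, Real.exp (s * (G x - ∫ x', G x' ∂(Measure.pi fun _ => P))) ∂(Measure.pi fun _ => P) ≤
      Real.exp (k * c ^ 2 * s ^ 2 / 8) := by
  induction k with
  | zero =>
    have : ∀ x, G x = G default := fun x => by rw [Subsingleton.elim x default]
    simp [this]
  | succ k ih =>
    have hmp := measurePreserving_finCons P k
    have hcons : Measurable fun p : Y × (Fin k → Y) => (Fin.cons p.1 p.2 : Fin (k + 1) → Y) :=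
      hmp.measurable
    have hGc : Measurable fun p : Y × (Fin k → Y) => G (Fin.cons p.1 p.2) := hG.comp hcons
    have hGy : ∀ y, Measurable fun x : Fin k → Y => G (Fin.cons y x) := fun y =>
      hGc.comp measurable_prodMk_left
    have hint : ∀ y, Integrable (fun x : Fin k → Y => G (Fin.cons y x))
        (Measure.pi fun _ => P) := fun y => integrable_of_abs_le (hGy y) fun x => hC _
    -- The conditional mean given the first coordinate. It inherits oscillation c, so Hoeffding's
    -- lemma handles g - M, while the induction hypothesis handles G - g with the first coordinate
    -- frozen.
    set g : Y → ℝ := fun y => ∫ x, G (Fin.cons y x) ∂(Measure.pi fun _ => P) with hg_def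
    have hg : Measurable g :=
      (hGc.stronglyMeasurable.integral_prod_right (ν := Measure.pi fun _ : Fin k => P)).measurable
    have hchange : ∀ H : (Fin (k + 1) → Y) → ℝ, Measurable H →
        ∫ x, H x ∂(Measure.pi fun _ => P) =
          ∫ p, H (Fin.cons p.1 p.2) ∂(P.prod (Measure.pi fun _ => P)) := fun H hH => by
      rw [← hmp.map_eq, integral_map hcons.aemeasurable hH.aestronglyMeasurable]
    have hmean : ∫ x, G x ∂(Measure.pi fun _ => P) = ∫ y, g y ∂P := by
      rw [hchange G hG, integral_prod _ (integrable_of_abs_le hGc fun _ => hC _)]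
    have hgc : ∀ y y', g y - g y' ≤ c := fun y y' => by
      rw [hg_def]
      simp only
      rw [← integral_sub (hint y) (hint y')]
      refine (integral_mono ((hint y).sub (hint y')) (integrable_const c) fun x => ?_).trans
        (by simp)
      exact hc 0 _ _ fun j hj => by
        obtain ⟨j', rfl⟩ := Fin.exists_succ_eq.2 hj
        simp
    have hgC : ∀ y, |g y| ≤ C := fun y => by
      have := norm_integral_le_of_norm_le_const (μ := Measure.pi fun _ : Fin k => P)
        (f := fun x => G (Fin.cons y x)) (C := C) (ae_of_all _ fun x => hC _)
      simpa using this
    set M := ∫ y, g y ∂P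
    have hM : |M| ≤ C := by
      have := norm_integral_le_of_norm_le_const (μ := P) (f := g) (C := C) (ae_of_all _ hgC)
      simpa using this
    have hexp_bdd : ∀ u v : ℝ, |u| ≤ C → |v| ≤ C →
        |Real.exp (s * (u - v))| ≤ Real.exp (|s| * (C + C)) := fun u v hu hv => by
      rw [abs_of_pos (Real.exp_pos _)]
      refine Real.exp_le_exp.2 ((le_abs_self _).trans ?_)
      rw [abs_mul]
      exact mul_le_mul_of_nonneg_left ((abs_sub _ _).trans (add_le_add hu hv)) (abs_nonneg s)
    rw [hmean, hchange _ (by fun_prop), integral_prod _ (integrable_of_abs_le (by fun_prop)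
      fun p => hexp_bdd _ _ (hC _) hM)]
    have hinner : ∀ y, ∫ x, Real.exp (s * (G (Fin.cons y x) - M)) ∂(Measure.pi fun _ => P) ≤
        Real.exp (s * (g y - M)) * Real.exp (k * c ^ 2 * s ^ 2 / 8) := fun y => by
      have h1 := ih (hGy y) (fun x => hC _) fun i x x' hxx' => hc i.succ _ _ fun j hj => by
        induction j using Fin.cases with
        | zero => simp
        | succ j' => simpa using hxx' j' (by rintro rfl; exact hj rfl)
      calc _ = ∫ x, Real.exp (s * (g y - M)) * Real.exp (s * (G (Fin.cons y x) - g y))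
            ∂(Measure.pi fun _ => P) := by
            refine integral_congr_ae (ae_of_all _ fun x => ?_)
            simp only
            rw [← Real.exp_add]
            ring_nf
        _ = Real.exp (s * (g y - M)) * ∫ x, Real.exp (s * (G (Fin.cons y x) - g y))
            ∂(Measure.pi fun _ => P) := integral_const_mul _ _
        _ ≤ _ := mul_le_mul_of_nonneg_left h1 (Real.exp_pos _).le
    have hI1 : Integrable (fun y => Real.exp (s * (g y - M))) P :=
      integrable_of_abs_le (by fun_prop) fun y => hexp_bdd _ _ (hgC y) hM
    calc _ ≤ ∫ y, Real.exp (s * (g y - M)) * Real.exp (k * c ^ 2 * s ^ 2 / 8) ∂P :=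
          integral_mono_of_nonneg (ae_of_all _ fun y => integral_nonneg fun x => (Real.exp_pos _).le)
            (hI1.mul_const _) (ae_of_all _ hinner)
      _ = (∫ y, Real.exp (s * (g y - M)) ∂P) * Real.exp (k * c ^ 2 * s ^ 2 / 8) :=
          integral_mul_const _ _
      _ ≤ Real.exp (c ^ 2 * s ^ 2 / 8) * Real.exp (k * c ^ 2 * s ^ 2 / 8) :=
          mul_le_mul_of_nonneg_right (integral_exp_le_of_sub_le P hg hgc s) (Real.exp_pos _).le
      _ = _ := by
          rw [← Real.exp_add]
          push_cast
          ring_nf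

end McDiarmid

/-! ### Averages over signs -/

section Signs

variable {ι : Type*} {k : ℕ}

/-- The sum `∑ σ_j v_j`. -/
def signSum (σ : Fin k → ℤˣ) (v : Fin k → ℝ) : ℝ := ∑ j, (((σ j : ℤˣ) : ℤ) : ℝ) * v j

/-- The average over all signs of the supremum of signed sums. -/
noncomputable def signAvg (v : ι → Fin k → ℝ) : ℝ :=
  ((2 : ℝ) ^ k)⁻¹ * ∑ σ : Fin k → ℤˣ, ⨆ i, (1 / (k : ℝ)) * signSum σ (v i)

theorem empRademacher_eq {Y : Type*} (Ψ : Set (Y → ℝ)) (y : Fin k → Y) :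
    empRademacher Ψ y = signAvg fun (ψ : Ψ) j => (ψ : Y → ℝ) (y j) := rfl

theorem abs_sign (s : ℤˣ) : |((s : ℤ) : ℝ)| = 1 := by
  rcases Int.units_eq_one_or s with rfl | rfl <;> simp

theorem abs_signSum_le (σ : Fin k → ℤˣ) {v : Fin k → ℝ} {C : ℝ} (hv : ∀ j, |v j| ≤ C) :
    |signSum σ v| ≤ k * C := by
  refine (Finset.abs_sum_le_sum_abs _ _).trans ?_
  refine (Finset.sum_le_card_nsmul _ _ C fun j _ => ?_).trans (by simp)
  rw [abs_mul, abs_sign, one_mul]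
  exact hv j

theorem abs_avg_signSum_le (σ : Fin k → ℤˣ) {v : Fin k → ℝ} {C : ℝ} (hC : 0 ≤ C)
    (hv : ∀ j, |v j| ≤ C) : |(1 / (k : ℝ)) * signSum σ v| ≤ C := by
  rw [abs_mul, abs_of_nonneg (by positivity : 0 ≤ 1 / (k : ℝ))]
  refine (mul_le_mul_of_nonneg_left (abs_signSum_le σ hv) (by positivity)).trans ?_
  -- For k = 0 the factor 1 / k is 0, so the claim reduces to 0 ≤ C.
  rcases Nat.eq_zero_or_pos k with rfl | hk
  · simpa using hC
  · have : (k : ℝ) ≠ 0 := by positivity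
    field_simp
    rfl

theorem sum_signs_succ (H : (Fin (k + 1) → ℤˣ) → ℝ) :
    ∑ σ, H σ = ∑ σ : Fin k → ℤˣ, (H (Fin.cons 1 σ) + H (Fin.cons (-1) σ)) := by
  rw [← (Fin.consEquiv fun _ : Fin (k + 1) => ℤˣ).sum_comp, Fintype.sum_prod_type,
    Finset.sum_add_distrib]
  simp [UnitsInt.univ, Fin.consEquiv]

theorem signSum_cons (s : ℤˣ) (σ : Fin k → ℤˣ) (v : Fin (k + 1) → ℝ) :
    signSum (Fin.cons s σ) v = ((s : ℤ) : ℝ) * v 0 + signSum σ fun j => v j.succ := by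
  simp [signSum, Fin.sum_univ_succ]

/-- For a pair (i, i') the left side is at most A i + A i' + |v i - v i'|; the sign of v i - v i'
tells which index to use in which supremum on the right. This is the one-coordinate contraction. -/
theorem ciSup_add_ciSup_le_of_abs_sub_le [Nonempty ι] {A v w : ι → ℝ} {C : ℝ}
    (hA : ∀ i, |A i| ≤ C) (hv : ∀ i, |v i| ≤ C) (h : ∀ i i', |w i - w i'| ≤ |v i - v i'|) :
    (⨆ i, (A i + w i)) + ⨆ i, (A i - w i) ≤ (⨆ i, (A i + v i)) + ⨆ i, (A i - v i) := by
  have h1 : BddAbove (range fun i => A i + v i) := bddAbove_range_of_abs_le (C := C + C) fun i =>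
    (abs_add_le _ _).trans (add_le_add (hA i) (hv i))
  have h2 : BddAbove (range fun i => A i - v i) := bddAbove_range_of_abs_le (C := C + C) fun i =>
    (abs_sub _ _).trans (add_le_add (hA i) (hv i))
  refine ciSup_add_ciSup_le fun i i' => ?_
  have h3 := (le_abs_self _).trans (h i i')
  have a1 := le_ciSup h1 i
  have a2 := le_ciSup h1 i'
  have b1 := le_ciSup h2 i
  have b2 := le_ciSup h2 i'
  rcases abs_cases (v i - v i') with ⟨h4, -⟩ | ⟨h4, -⟩ <;> rw [h4] at h3 <;> linarith

/-- The **contraction principle** for sums over signs. -/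
theorem sum_ciSup_signSum_le [Nonempty ι] {A : ι → ℝ} {v w : ι → Fin k → ℝ} {C : ℝ}
    (hA : ∀ i, |A i| ≤ C) (hv : ∀ i j, |v i j| ≤ C) (hw : ∀ i j, |w i j| ≤ C)
    (h : ∀ j i i', |w i j - w i' j| ≤ |v i j - v i' j|) :
    ∑ σ : Fin k → ℤˣ, ⨆ i, (A i + signSum σ (w i)) ≤
      ∑ σ : Fin k → ℤˣ, ⨆ i, (A i + signSum σ (v i)) := by
  obtain ⟨i₀⟩ := ‹Nonempty ι›
  have hC : 0 ≤ C := (abs_nonneg _).trans (hA i₀)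
  have : Nonempty ι := ⟨i₀⟩
  induction k generalizing A C with
  | zero => simp [signSum]
  | succ k ih =>
    rw [sum_signs_succ, sum_signs_succ]
    simp only [signSum_cons, Units.val_one, Int.cast_one, one_mul, Units.val_neg, Int.cast_neg,
      neg_mul]
    -- With the first sign frozen at e, the term e * w i 0 joins the offset A, which is why the
    -- induction carries an arbitrary offset. The bound grows to C + C.
    have hstep : ∀ e : ℝ, |e| = 1 →
        ∑ σ : Fin k → ℤˣ, ⨆ i, (A i + (e * w i 0 + signSum σ fun j => w i j.succ)) ≤
        ∑ σ : Fin k → ℤˣ, ⨆ i, (A i + (e * w i 0 + signSum σ fun j => v i j.succ)) := fun e he => by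
      simp only [← add_assoc]
      refine ih (A := fun i => A i + e * w i 0) (C := C + C) (fun i => ?_)
        (fun i j => (hv i _).trans (by linarith)) (fun i j => (hw i _).trans (by linarith))
        (fun j i i' => h _ _ _) (by linarith)
      refine (abs_add_le _ _).trans (add_le_add (hA i) ?_)
      rw [abs_mul, he, one_mul]
      exact hw i 0
    have h1 := hstep 1 (by simp)
    have h2 := hstep (-1) (by simp)
    simp only [one_mul, neg_mul] at h1 h2
    rw [Finset.sum_add_distrib]
    refine (add_le_add h1 h2).trans ?_
    rw [← Finset.sum_add_distrib]
    refine Finset.sum_le_sum fun σ _ => ?_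
    -- The first coordinate is replaced last, with both of its signs considered together.
    have h3 := ciSup_add_ciSup_le_of_abs_sub_le (C := C + k * C)
      (A := fun i => A i + signSum σ fun j => v i j.succ) (v := fun i => v i 0)
      (w := fun i => w i 0)
      (fun i => (abs_add_le _ _).trans (add_le_add (hA i) (abs_signSum_le σ fun j => hv i _)))
      (fun i => (hv i 0).trans (by linarith [mul_nonneg (Nat.cast_nonneg (α := ℝ) k) hC])) (h 0)
    have e1 : ∀ i, A i + (w i 0 + signSum σ fun j => v i j.succ) =
        A i + (signSum σ fun j => v i j.succ) + w i 0 := fun i => by ring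
    have e2 : ∀ i, A i + (-w i 0 + signSum σ fun j => v i j.succ) =
        A i + (signSum σ fun j => v i j.succ) - w i 0 := fun i => by ring
    have e3 : ∀ i, A i + (v i 0 + signSum σ fun j => v i j.succ) =
        A i + (signSum σ fun j => v i j.succ) + v i 0 := fun i => by ring
    have e4 : ∀ i, A i + (-v i 0 + signSum σ fun j => v i j.succ) =
        A i + (signSum σ fun j => v i j.succ) - v i 0 := fun i => by ring
    simpa only [e1, e2, e3, e4] using h3

theorem signAvg_mono_of_abs_sub_le [Nonempty ι] {v w : ι → Fin k → ℝ} {C : ℝ}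
    (hv : ∀ i j, |v i j| ≤ C) (hw : ∀ i j, |w i j| ≤ C) (hC : 0 ≤ C)
    (h : ∀ j i i', |w i j - w i' j| ≤ |v i j - v i' j|) : signAvg w ≤ signAvg v := by
  have := sum_ciSup_signSum_le (A := fun _ => 0) (by simpa using fun _ : ι => hC) hv hw h
  simp only [zero_add] at this
  unfold signAvg
  simp only [← Real.mul_iSup_of_nonneg (by positivity : 0 ≤ 1 / (k : ℝ)), ← Finset.mul_sum]
  gcongr

theorem signAvg_const_mul {e : ℝ} (he : 0 ≤ e) (v : ι → Fin k → ℝ) :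
    signAvg (fun i j => e * v i j) = e * signAvg v := by
  unfold signAvg
  have : ∀ σ : Fin k → ℤˣ, ⨆ i, (1 / (k : ℝ)) * signSum σ (fun j => e * v i j) =
      e * ⨆ i, (1 / (k : ℝ)) * signSum σ (v i) := fun σ => by
    rw [Real.mul_iSup_of_nonneg he]
    congr 1
    ext i
    simp only [signSum, Finset.mul_sum]
    refine Finset.sum_congr rfl fun j _ => ?_
    ring
  simp only [this, ← Finset.mul_sum]
  ring

theorem signAvg_add_le [Nonempty ι] {v w : ι → Fin k → ℝ} {C : ℝ} (hC : 0 ≤ C)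
    (hv : ∀ i j, |v i j| ≤ C) (hw : ∀ i j, |w i j| ≤ C) :
    signAvg (fun i j => v i j + w i j) ≤ signAvg v + signAvg w := by
  unfold signAvg
  rw [← mul_add, ← Finset.sum_add_distrib]
  refine mul_le_mul_of_nonneg_left (Finset.sum_le_sum fun σ _ => ?_) (by positivity)
  refine ciSup_le fun i => ?_
  refine le_trans (le_of_eq ?_) (add_le_add
    (le_ciSup (bddAbove_range_of_abs_le fun i => abs_avg_signSum_le σ hC (hv i)) i)
    (le_ciSup (bddAbove_range_of_abs_le fun i => abs_avg_signSum_le σ hC (hw i)) i))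
  simp only [signSum, ← mul_add, ← Finset.sum_add_distrib]

theorem abs_signAvg_le [Nonempty ι] {v : ι → Fin k → ℝ} {C : ℝ} (hC : 0 ≤ C)
    (hv : ∀ i j, |v i j| ≤ C) : |signAvg v| ≤ C := by
  have hcard : (Fintype.card (Fin k → ℤˣ) : ℝ) = 2 ^ k := by simp
  unfold signAvg
  rw [abs_mul, abs_of_pos (by positivity)]
  have h1 : |∑ σ : Fin k → ℤˣ, ⨆ i, (1 / (k : ℝ)) * signSum σ (v i)| ≤ 2 ^ k * C := by
    refine (Finset.abs_sum_le_sum_abs _ _).trans ?_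
    refine (Finset.sum_le_card_nsmul _ _ C fun σ _ =>
      abs_ciSup_le fun i => abs_avg_signSum_le σ hC (hv i)).trans ?_
    rw [nsmul_eq_mul, Finset.card_univ, hcard]
  calc _ ≤ ((2 : ℝ) ^ k)⁻¹ * (2 ^ k * C) := by gcongr
    _ = C := by field_simp

theorem sum_signSum (v : Fin k → ℝ) : ∑ σ : Fin k → ℤˣ, signSum σ v = 0 := by
  induction k with
  | zero => simp [signSum]
  | succ k ih =>
    rw [sum_signs_succ]
    simp only [signSum_cons, Finset.sum_add_distrib, ih]
    simp

theorem sum_signSum_one_sq : ∑ σ : Fin k → ℤˣ, signSum σ (fun _ => 1) ^ 2 = 2 ^ k * k := by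
  induction k with
  | zero => simp [signSum]
  | succ k ih =>
    rw [sum_signs_succ]
    simp only [signSum_cons]
    have : ∀ σ : Fin k → ℤˣ,
        ((((1 : ℤˣ) : ℤ) : ℝ) * 1 + signSum σ fun _ => 1) ^ 2 +
        ((((-1 : ℤˣ) : ℤ) : ℝ) * 1 + signSum σ fun _ => 1) ^ 2 =
        2 + 2 * signSum σ (fun _ => 1) ^ 2 := fun σ => by
      push_cast
      ring
    simp only [this, Finset.sum_add_distrib, ← Finset.mul_sum, ih]
    simp
    ring

/-- Cauchy–Schwarz applied to the second moment k of a sum of k independent signs. -/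
theorem sum_abs_signSum_one_le : ∑ σ : Fin k → ℤˣ, |signSum σ (fun _ => 1)| ≤ 2 ^ k * √(k : ℝ) := by
  have hcard : (Fintype.card (Fin k → ℤˣ) : ℝ) = 2 ^ k := by simp
  have h := sq_sum_le_card_mul_sum_sq (s := Finset.univ)
    (f := fun σ : Fin k → ℤˣ => |signSum σ (fun _ => 1)|)
  simp only [sq_abs, sum_signSum_one_sq, Finset.card_univ, hcard] at h
  refine (abs_le_of_sq_le_sq' (h.trans (le_of_eq ?_)) (by positivity)).2
  rw [mul_pow, Real.sq_sqrt (Nat.cast_nonneg k)]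
  ring

/-- A shift constant across the sample only multiplies the sum of the signs, which has mean zero and
mean absolute value at most √k. The centre c therefore costs nothing, and only the radius r of the
set of shifts is paid for. -/
theorem signAvg_sub_le {κ : Type*} [Nonempty ι] [Nonempty κ] (hk : 0 < k) {v : ι → Fin k → ℝ}
    {C : ℝ} (hC : 0 ≤ C) (hv : ∀ i j, |v i j| ≤ C) {ν : κ → ℝ} {c r : ℝ}
    (hν : ∀ p, |ν p - c| ≤ r) :
    signAvg (fun (q : ι × κ) j => v q.1 j - ν q.2) ≤ signAvg v + r / √(k : ℝ) := by
  obtain ⟨p₀⟩ := ‹Nonempty κ›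
  have : Nonempty κ := ⟨p₀⟩
  have hr : 0 ≤ r := (abs_nonneg _).trans (hν p₀)
  have hk' : (0 : ℝ) < k := by exact_mod_cast hk
  have hσ : ∀ σ : Fin k → ℤˣ,
      ⨆ q : ι × κ, (1 / (k : ℝ)) * signSum σ (fun j => v q.1 j - ν q.2) ≤
      (⨆ i, (1 / (k : ℝ)) * signSum σ (v i)) +
        (-(c / k) * signSum σ (fun _ => 1) + r / k * |signSum σ (fun _ => 1)|) := fun σ => by
    refine ciSup_le fun q => ?_
    have h1 := le_ciSup (bddAbove_range_of_abs_le fun i => abs_avg_signSum_le σ hC (hv i)) q.1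
    have h2 : signSum σ (fun j => v q.1 j - ν q.2) =
        signSum σ (v q.1) - ν q.2 * signSum σ (fun _ => 1) := by
      simp only [signSum, Finset.mul_sum, ← Finset.sum_sub_distrib]
      exact Finset.sum_congr rfl fun j _ => by ring
    have h3 : -(ν q.2 - c) * signSum σ (fun _ => 1) ≤ r * |signSum σ (fun _ => 1)| := by
      refine (le_abs_self _).trans ?_
      rw [abs_mul, abs_neg]
      exact mul_le_mul_of_nonneg_right (hν _) (abs_nonneg _)
    have h4 := mul_le_mul_of_nonneg_left h3 (by positivity : 0 ≤ 1 / (k : ℝ))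
    rw [h2]
    have e1 : 1 / (k : ℝ) * (signSum σ (v q.1) - ν q.2 * signSum σ fun _ => 1) =
        1 / (k : ℝ) * signSum σ (v q.1) + (-(c / k) * signSum σ (fun _ => 1) +
          1 / (k : ℝ) * (-(ν q.2 - c) * signSum σ fun _ => 1)) := by ring
    have e2 : r / k * |signSum σ (fun _ => 1)| = 1 / (k : ℝ) * (r * |signSum σ fun _ => 1|) := by
      ring
    rw [e1, e2]
    gcongr
  unfold signAvg
  refine (mul_le_mul_of_nonneg_left (Finset.sum_le_sum fun σ _ => hσ σ) (by positivity)).trans ?_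
  rw [Finset.sum_add_distrib, Finset.sum_add_distrib, ← Finset.mul_sum, ← Finset.mul_sum,
    sum_signSum, mul_zero, zero_add, mul_add]
  refine add_le_add_right ?_ _
  calc ((2 : ℝ) ^ k)⁻¹ * (r / k * ∑ σ : Fin k → ℤˣ, |signSum σ (fun _ => 1)|)
      ≤ ((2 : ℝ) ^ k)⁻¹ * (r / k * (2 ^ k * √(k : ℝ))) := by
        gcongr
        exact sum_abs_signSum_one_le
    _ = r * (√(k : ℝ) / k) := by field_simp
    _ = r / √(k : ℝ) := by rw [Real.sqrt_div_self, div_eq_mul_inv]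

end Signs

section SignAvg

variable {ι : Type*} {k : ℕ}

/-- A single index already averages to zero over the signs. -/
theorem signAvg_nonneg [Nonempty ι] {v : ι → Fin k → ℝ} {C : ℝ} (hC : 0 ≤ C)
    (hv : ∀ i j, |v i j| ≤ C) : 0 ≤ signAvg v := by
  obtain ⟨i⟩ := ‹Nonempty ι›
  refine mul_nonneg (by positivity) ?_
  calc (0 : ℝ) = ∑ σ : Fin k → ℤˣ, (1 / (k : ℝ)) * signSum σ (v i) := by
        rw [← Finset.mul_sum, sum_signSum, mul_zero]
    _ ≤ _ := Finset.sum_le_sum fun σ _ =>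
        le_ciSup (bddAbove_range_of_abs_le fun i => abs_avg_signSum_le σ hC (hv i)) i

theorem signAvg_neg (v : ι → Fin k → ℝ) : signAvg (fun i j => -v i j) = signAvg v := by
  unfold signAvg
  congr 1
  refine Fintype.sum_equiv (Equiv.neg _) _ _ fun σ => ?_
  simp [signSum]

theorem signAvg_comp_le {κ : Type*} [Nonempty κ] {v : ι → Fin k → ℝ} {C : ℝ} (hC : 0 ≤ C)
    (hv : ∀ i j, |v i j| ≤ C) (g : κ → ι) : signAvg (fun q => v (g q)) ≤ signAvg v :=
  mul_le_mul_of_nonneg_left (Finset.sum_le_sum fun σ _ => ciSup_le fun q =>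
    le_ciSup (bddAbove_range_of_abs_le fun i => abs_avg_signSum_le σ hC (hv i)) (g q))
    (by positivity)

/-- For fixed signs the signed sum is continuous in the vector of values, so the supremum is
determined on a dense subfamily. -/
theorem signAvg_eq_of_mem_closure {κ : Type*} [Nonempty ι] [Nonempty κ] {v : ι → Fin k → ℝ}
    {C : ℝ} (hC : 0 ≤ C) (hv : ∀ i j, |v i j| ≤ C) {g : κ → ι}
    (hg : ∀ i, v i ∈ closure (range fun q => v (g q))) :
    signAvg v = signAvg fun q => v (g q) := by
  refine le_antisymm ?_ (signAvg_comp_le hC hv g)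
  refine mul_le_mul_of_nonneg_left (Finset.sum_le_sum fun σ _ => ciSup_le fun i => ?_)
    (by positivity)
  have hcl : IsClosed {u : Fin k → ℝ | (1 / (k : ℝ)) * signSum σ u ≤
      ⨆ q, (1 / (k : ℝ)) * signSum σ (v (g q))} := by
    refine isClosed_le ?_ continuous_const
    unfold signSum
    fun_prop
  refine hcl.closure_subset_iff.2 ?_ (hg i)
  rintro _ ⟨q, rfl⟩
  exact le_ciSup (bddAbove_range_of_abs_le
    (u := fun q => (1 / (k : ℝ)) * signSum σ (v (g q)))
    fun q => abs_avg_signSum_le σ hC (hv (g q))) q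

theorem measurable_signSum_comp {Y : Type*} [MeasurableSpace Y] (σ : Fin k → ℤˣ) {ψ : Y → ℝ}
    (hψ : Measurable ψ) : Measurable fun y : Fin k → Y => signSum σ fun j => ψ (y j) := by
  unfold signSum
  fun_prop

theorem measurable_signAvg_comp {Y : Type*} [MeasurableSpace Y] [Countable ι] {ψ : ι → Y → ℝ}
    (hψ : ∀ i, Measurable (ψ i)) :
    Measurable fun y : Fin k → Y => signAvg fun i j => ψ i (y j) := by
  unfold signAvg
  exact measurable_const.mul (Finset.measurable_sum _ fun σ _ =>
    Measurable.iSup fun i => measurable_const.mul (measurable_signSum_comp σ (hψ i)))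

end SignAvg

/-! ### Symmetrization -/

section Symmetrization

variable {ι Y : Type*} [MeasurableSpace Y] {P : Measure Y} [IsProbabilityMeasure P] {k : ℕ}

theorem integral_avg_eq (hk : 0 < k) {ψ : Y → ℝ} (hψ : Integrable ψ P) :
    ∫ y, (1 / (k : ℝ)) * ∑ j, ψ (y j) ∂(Measure.pi fun _ : Fin k => P) = ∫ y, ψ y ∂P := by
  have hk' : (k : ℝ) ≠ 0 := by positivity
  have hmp : ∀ j, MeasurePreserving (Function.eval j) (Measure.pi fun _ : Fin k => P) P :=
    fun j => measurePreserving_eval (fun _ : Fin k => P) j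
  have hi : ∀ j, ∫ y : Fin k → Y, ψ (y j) ∂(Measure.pi fun _ => P) = ∫ y, ψ y ∂P := fun j => by
    rw [← (hmp j).map_eq] at hψ
    conv_rhs => rw [← (hmp j).map_eq]
    rw [integral_map (hmp j).measurable.aemeasurable hψ.aestronglyMeasurable]
  have hint : ∀ j, Integrable (fun y : Fin k → Y => ψ (y j)) (Measure.pi fun _ => P) :=
    fun j => (hmp j).integrable_comp_of_integrable hψ
  rw [integral_const_mul, integral_finsetSum _ fun j _ => hint j]
  simp [hi, hk']

/-- Symmetrization by a ghost sample: the true mean becomes the mean over an independent copy, and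
then coordinates of the two copies are exchanged according to the signs. -/
theorem integral_ciSup_avg_sub_le [Countable ι] [Nonempty ι] (hk : 0 < k) {ψ : ι → Y → ℝ}
    (hψ : ∀ i, Measurable (ψ i)) {C : ℝ} (hC : ∀ i y, |ψ i y| ≤ C) :
    ∫ y, (⨆ i, ((1 / (k : ℝ)) * ∑ j, ψ i (y j) - ∫ y', ψ i y' ∂P))
        ∂(Measure.pi fun _ : Fin k => P) ≤
      2 * ∫ y, signAvg (fun i j => ψ i (y j)) ∂(Measure.pi fun _ : Fin k => P) := by
  obtain ⟨i₀⟩ := id ‹Nonempty ι›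
  obtain ⟨y₀⟩ : Nonempty Y := nonempty_of_isProbabilityMeasure P
  have hC0 : 0 ≤ C := (abs_nonneg _).trans (hC i₀ y₀)
  set π := Measure.pi fun _ : Fin k => P
  set π₂ := Measure.pi fun _ : Fin k => P.prod P
  have hψi : ∀ i, Integrable (ψ i) P := fun i => integrable_of_abs_le (hψ i) (hC i)
  let avg : ι → (Fin k → Y) → ℝ := fun i y => (1 / (k : ℝ)) * ∑ j, ψ i (y j)
  have havg_m : ∀ i, Measurable (avg i) := fun i => by
    have := hψ i
    fun_prop
  have havg_b : ∀ i y, |avg i y| ≤ C := fun i y => by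
    have := abs_avg_signSum_le (fun _ : Fin k => 1) hC0 (v := fun j => ψ i (y j)) fun j => hC i _
    simpa [signSum, avg] using this
  have hmean : ∀ i, |∫ y, ψ i y ∂P| ≤ C := fun i => by
    have := norm_integral_le_of_norm_le_const (μ := P) (f := ψ i) (C := C) (ae_of_all _ (hC i))
    simpa using this
  let A : (Fin k → ℤˣ) → (Fin k → Y) → ℝ := fun σ y =>
    ⨆ i, (1 / (k : ℝ)) * signSum σ fun j => ψ i (y j)
  have hAbd : ∀ σ i (y : Fin k → Y), |(1 / (k : ℝ)) * signSum σ fun j => ψ i (y j)| ≤ C :=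
    fun σ i y => abs_avg_signSum_le σ hC0 fun j => hC i _
  have hA_m : ∀ σ, Measurable (A σ) := fun σ =>
    Measurable.iSup fun i => measurable_const.mul (measurable_signSum_comp σ (hψ i))
  have hA_i : ∀ σ, Integrable (A σ) π := fun σ =>
    integrable_of_abs_le (hA_m σ) fun y => abs_ciSup_le fun i => hAbd σ i y
  let D : (Fin k → Y) × (Fin k → Y) → ℝ := fun p => ⨆ i, (avg i p.1 - avg i p.2)
  have hDbd : ∀ i (p : (Fin k → Y) × (Fin k → Y)), |avg i p.1 - avg i p.2| ≤ C + C := fun i p =>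
    (abs_sub _ _).trans (add_le_add (havg_b i _) (havg_b i _))
  have hD_m : Measurable D := Measurable.iSup fun i =>
    ((havg_m i).comp measurable_fst).sub ((havg_m i).comp measurable_snd)
  have hD_b : ∀ p, |D p| ≤ C + C := fun p => abs_ciSup_le fun i => hDbd i p
  have hD_i : Integrable D (π.prod π) := integrable_of_abs_le hD_m hD_b
  -- The supremum of an integral over the ghost sample is at most the integral of the supremum.
  have hstep1 : ∫ y, (⨆ i, (avg i y - ∫ y', ψ i y' ∂P)) ∂π ≤ ∫ p, D p ∂(π.prod π) := by
    rw [integral_prod _ hD_i]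
    refine integral_mono ?_ hD_i.integral_prod_left fun y => ?_
    · exact integrable_of_abs_le (Measurable.iSup fun i => (havg_m i).sub_const _)
        fun y => abs_ciSup_le fun i => (abs_sub _ _).trans (add_le_add (havg_b i y) (hmean i))
    · refine ciSup_le fun i => ?_
      have hi2 : Integrable (avg i) π := integrable_of_abs_le (havg_m i) (havg_b i)
      rw [← integral_avg_eq hk (hψi i)]
      calc avg i y - ∫ y', avg i y' ∂π = ∫ y', (avg i y - avg i y') ∂π := by
            rw [integral_sub (integrable_const _) hi2]
            simp
        _ ≤ ∫ y', D (y, y') ∂π := by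
            refine integral_mono ((integrable_const _).sub hi2)
              (integrable_of_abs_le (hD_m.comp measurable_prodMk_left) fun y' => hD_b _) fun y' => ?_
            exact le_ciSup (f := fun i => avg i y - avg i y')
              (bddAbove_range_of_abs_le fun i => hDbd i (y, y')) i
  have hfst : MeasurePreserving (fun (q : Fin k → Y × Y) j => (q j).1) π₂ π :=
    measurePreserving_pi _ _ fun _ => measurePreserving_fst
  have hsnd : MeasurePreserving (fun (q : Fin k → Y × Y) j => (q j).2) π₂ π :=
    measurePreserving_pi _ _ fun _ => measurePreserving_snd
  have hpair : MeasurePreserving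
      (fun q : Fin k → Y × Y => ((fun j => (q j).1, fun j => (q j).2) :
        (Fin k → Y) × (Fin k → Y))) π₂ (π.prod π) :=
    measurePreserving_arrowProdEquivProdArrow Y Y (Fin k) (fun _ => P) (fun _ => P)
  have hstep2 : ∀ σ : Fin k → ℤˣ, ∫ p, D p ∂(π.prod π) ≤ ∫ y, A σ y ∂π + ∫ y, A (-σ) y ∂π := by
    intro σ
    -- Exchange the copies at the coordinates where σ is -1. The law is invariant, and the
    -- difference of averages becomes a σ-signed sum over the first copy plus a (-σ)-signed sum over
    -- the second.
    have hsw : MeasurePreserving (fun (q : Fin k → Y × Y) j =>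
        (if σ j = 1 then id else Prod.swap : Y × Y → Y × Y) (q j)) π₂ π₂ :=
      measurePreserving_pi _ _ fun j => by
        split_ifs
        · exact MeasurePreserving.id _
        · exact Measure.measurePreserving_swap
    have hch := hpair.comp hsw
    have hA1 : Integrable (fun q : Fin k → Y × Y => A σ fun j => (q j).1) π₂ :=
      hfst.integrable_comp_of_integrable (hA_i σ)
    have hA2 : Integrable (fun q : Fin k → Y × Y => A (-σ) fun j => (q j).2) π₂ :=
      hsnd.integrable_comp_of_integrable (hA_i (-σ))
    have hmap : ∀ {g : (Fin k → Y × Y) → (Fin k → Y)} (_ : MeasurePreserving g π₂ π) τ,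
        ∫ y, A τ y ∂π = ∫ q, A τ (g q) ∂π₂ := fun {g} hg τ => by
      rw [← hg.map_eq, integral_map hg.measurable.aemeasurable (hA_m τ).aestronglyMeasurable]
    rw [hmap hfst, hmap hsnd, ← integral_add hA1 hA2, ← hch.map_eq,
      integral_map hch.measurable.aemeasurable hD_m.aestronglyMeasurable]
    refine integral_mono (hch.integrable_comp_of_integrable hD_i) (hA1.add hA2) fun q => ?_
    refine ciSup_le fun i => ?_
    refine le_trans (le_of_eq ?_) (add_le_add
      (le_ciSup (bddAbove_range_of_abs_le fun i => hAbd σ i fun j => (q j).1) i)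
      (le_ciSup (bddAbove_range_of_abs_le fun i => hAbd (-σ) i fun j => (q j).2) i))
    simp only [avg, signSum, ← mul_sub, ← mul_add, ← Finset.sum_sub_distrib,
      ← Finset.sum_add_distrib, Function.comp_apply]
    congr 1
    refine Finset.sum_congr rfl fun j _ => ?_
    rcases Int.units_eq_one_or (σ j) with h | h <;> simp [h] <;> ring
  have hcard : (Fintype.card (Fin k → ℤˣ) : ℝ) = 2 ^ k := by simp
  have hsumA : ∫ y, signAvg (fun i j => ψ i (y j)) ∂π =
      ((2 : ℝ) ^ k)⁻¹ * ∑ σ, ∫ y, A σ y ∂π := by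
    rw [← integral_finsetSum _ fun σ _ => hA_i σ, ← integral_const_mul]
    rfl
  have hneg : ∑ σ, ∫ y, A (-σ) y ∂π = ∑ σ, ∫ y, A σ y ∂π :=
    Fintype.sum_equiv (Equiv.neg _) _ _ fun σ => rfl
  have hstep3 := Finset.sum_le_sum fun σ (_ : σ ∈ Finset.univ) => hstep2 σ
  rw [Finset.sum_const, Finset.sum_add_distrib, hneg, nsmul_eq_mul, Finset.card_univ, hcard]
    at hstep3
  refine hstep1.trans ?_
  rw [hsumA]
  calc ∫ p, D p ∂(π.prod π) = ((2 : ℝ) ^ k)⁻¹ * (2 ^ k * ∫ p, D p ∂(π.prod π)) := by field_simp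
    _ ≤ ((2 : ℝ) ^ k)⁻¹ * (∑ σ, ∫ y, A σ y ∂π + ∑ σ, ∫ y, A σ y ∂π) := by gcongr
    _ = _ := by ring

theorem integral_ciSup_sub_avg_le [Countable ι] [Nonempty ι] (hk : 0 < k) {ψ : ι → Y → ℝ}
    (hψ : ∀ i, Measurable (ψ i)) {C : ℝ} (hC : ∀ i y, |ψ i y| ≤ C) :
    ∫ y, (⨆ i, (∫ y', ψ i y' ∂P - (1 / (k : ℝ)) * ∑ j, ψ i (y j)))
        ∂(Measure.pi fun _ : Fin k => P) ≤
      2 * ∫ y, signAvg (fun i j => ψ i (y j)) ∂(Measure.pi fun _ : Fin k => P) := by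
  have := integral_ciSup_avg_sub_le (P := P) hk (ψ := fun i y => -ψ i y) (fun i => (hψ i).neg)
    (C := C) (fun i y => by rw [abs_neg]; exact hC i y)
  simp only [signAvg_neg, integral_neg, Finset.sum_neg_distrib, mul_neg, sub_neg_eq_add,
    neg_add_eq_sub] at this
  exact this

end Symmetrization

/-! ### Concentration of a sum of two independent functions with bounded differences -/

/-- A bounded measurable function of `k` variables which changes by at most `c` when one of the
variables is changed. -/
structure HasBoundedDiff {Y : Type*} [MeasurableSpace Y] {k : ℕ} (G : (Fin k → Y) → ℝ) (c : ℝ) :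
    Prop where
  measurable : Measurable G
  bounded : ∃ C, ∀ x, |G x| ≤ C
  sub_le : ∀ i x x', (∀ j ≠ i, x j = x' j) → G x - G x' ≤ c

namespace HasBoundedDiff

variable {Y : Type*} [MeasurableSpace Y] {k : ℕ} {G G' : (Fin k → Y) → ℝ} {c c' : ℝ}

theorem add (h : HasBoundedDiff G c) (h' : HasBoundedDiff G' c') :
    HasBoundedDiff (fun x => G x + G' x) (c + c') := by
  obtain ⟨C, hC⟩ := h.bounded
  obtain ⟨C', hC'⟩ := h'.bounded
  refine ⟨h.measurable.add h'.measurable, ⟨C + C', fun x => (abs_add_le _ _).trans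
    (add_le_add (hC x) (hC' x))⟩, fun i x x' hx => ?_⟩
  linarith [h.sub_le i x x' hx, h'.sub_le i x x' hx]

theorem ciSup {ι : Type*} [Countable ι] [Nonempty ι] {U : ι → (Fin k → Y) → ℝ}
    (hm : ∀ i, Measurable (U i)) {C : ℝ} (hC : ∀ i x, |U i x| ≤ C)
    (hc : ∀ i j x x', (∀ j' ≠ j, x j' = x' j') → U i x - U i x' ≤ c) :
    HasBoundedDiff (fun x => ⨆ i, U i x) c := by
  refine ⟨Measurable.iSup hm, ⟨C, fun x => abs_ciSup_le fun i => hC i x⟩, fun j x x' hx => ?_⟩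
  rw [sub_le_iff_le_add']
  exact ciSup_le_ciSup_add (bddAbove_range_of_abs_le fun i => hC i x') fun i => by
    linarith [hc i j x x' hx]

theorem integrable (h : HasBoundedDiff G c) (P : Measure (Fin k → Y)) [IsFiniteMeasure P] :
    Integrable G P :=
  integrable_of_abs_le h.measurable h.bounded.choose_spec

theorem integrable_exp {Ω : Type*} [MeasurableSpace Ω] {μ : Measure Ω} [IsFiniteMeasure μ]
    (h : HasBoundedDiff G c) {V : Ω → Fin k → Y} (hV : Measurable V) (s M : ℝ) :
    Integrable (fun ω => Real.exp (s * (G (V ω) - M))) μ := by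
  obtain ⟨C, hC⟩ := h.bounded
  have := h.measurable
  refine integrable_of_abs_le (by fun_prop) (C := Real.exp (|s| * (C + |M|))) fun ω => ?_
  rw [abs_of_pos (Real.exp_pos _)]
  refine Real.exp_le_exp.2 ((le_abs_self _).trans ?_)
  rw [abs_mul]
  exact mul_le_mul_of_nonneg_left ((abs_sub _ _).trans (add_le_add (hC _) le_rfl)) (abs_nonneg s)

theorem mgf_le {Ω : Type*} [MeasurableSpace Ω] {μ : Measure Ω} {P : Measure Y}
    [IsProbabilityMeasure P] (h : HasBoundedDiff G c) {V : Ω → Fin k → Y} (hV : Measurable V)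
    (hlaw : μ.map V = Measure.pi fun _ => P) (s : ℝ) :
    mgf (fun ω => G (V ω) - ∫ x, G x ∂(Measure.pi fun _ => P)) μ s ≤
      Real.exp (k * c ^ 2 * s ^ 2 / 8) := by
  obtain ⟨C, hC⟩ := h.bounded
  have h1 := integral_exp_le_of_bounded_differences P h.measurable hC h.sub_le s
  have := h.measurable
  rw [← hlaw, integral_map hV.aemeasurable (by fun_prop), hlaw] at h1
  exact h1

end HasBoundedDiff

theorem measureReal_ge_le_of_hasBoundedDiff {X Z Ω : Type*} [MeasurableSpace X] [MeasurableSpace Z]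
    [MeasurableSpace Ω] {μ : Measure Ω} [IsProbabilityMeasure μ] {Q : Measure X}
    [IsProbabilityMeasure Q] {PZ : Measure Z} [IsProbabilityMeasure PZ] {n m : ℕ}
    {xs : Fin n → Ω → X} {zs : Fin m → Ω → Z}
    (hxs_meas : ∀ i, Measurable (xs i)) (hzs_meas : ∀ j, Measurable (zs j))
    (hxs_law : ∀ i, Measure.map (xs i) μ = Q) (hzs_law : ∀ j, Measure.map (zs j) μ = PZ)
    (hxs_indep : iIndepFun xs μ) (hzs_indep : iIndepFun zs μ)
    (hxz_indep : IndepFun (fun ω i => xs i ω) (fun ω j => zs j ω) μ)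
    {T : (Fin n → X) → ℝ} {S : (Fin m → Z) → ℝ} {cT cS : ℝ}
    (hT : HasBoundedDiff T cT) (hS : HasBoundedDiff S cS)
    {V : ℝ} (hV : V = n * cT ^ 2 + m * cS ^ 2) (hV0 : 0 < V) {ε : ℝ} (hε : 0 < ε) :
    μ.real {ω | ε + ∫ x, T x ∂(Measure.pi fun _ => Q) + ∫ z, S z ∂(Measure.pi fun _ => PZ) ≤
        T (fun i => xs i ω) + S (fun j => zs j ω)} ≤ Real.exp (-(2 * ε ^ 2 / V)) := by
  have hX : Measurable fun ω i => xs i ω := measurable_pi_iff.2 hxs_meas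
  have hZ : Measurable fun ω j => zs j ω := measurable_pi_iff.2 hzs_meas
  have hXlaw : μ.map (fun ω i => xs i ω) = Measure.pi fun _ => Q := by
    rw [(iIndepFun_iff_map_fun_eq_pi_map fun i => (hxs_meas i).aemeasurable).1 hxs_indep]
    simp_rw [hxs_law]
  have hZlaw : μ.map (fun ω j => zs j ω) = Measure.pi fun _ => PZ := by
    rw [(iIndepFun_iff_map_fun_eq_pi_map fun i => (hzs_meas i).aemeasurable).1 hzs_indep]
    simp_rw [hzs_law]
  set MT := ∫ x, T x ∂(Measure.pi fun _ => Q)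
  set MS := ∫ z, S z ∂(Measure.pi fun _ => PZ)
  have hind : IndepFun (fun ω => T (fun i => xs i ω) - MT) (fun ω => S (fun j => zs j ω) - MS) μ :=
    hxz_indep.comp (hT.measurable.sub_const MT) (hS.measurable.sub_const MS)
  -- The minimizer of the Chernoff exponent -s ε + V s² / 8, with value -2 ε² / V.
  set s : ℝ := 4 * ε / V with hs
  have hs0 : 0 ≤ s := by positivity
  have hiT := hT.integrable_exp (μ := μ) hX s MT
  have hiS := hS.integrable_exp (μ := μ) hZ s MS
  have hcher := measure_ge_le_exp_mul_mgf (μ := μ) ε hs0 (hind.integrable_exp_mul_add hiT hiS)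
  rw [hind.mgf_add' ((hT.measurable.comp hX).sub_const MT).aestronglyMeasurable
    ((hS.measurable.comp hZ).sub_const MS).aestronglyMeasurable] at hcher
  have hset : {ω | ε + MT + MS ≤ T (fun i => xs i ω) + S (fun j => zs j ω)} =
      {ω | ε ≤ ((fun ω => T (fun i => xs i ω) - MT) + fun ω => S (fun j => zs j ω) - MS) ω} := by
    ext ω
    simp only [mem_ofPred_eq, Pi.add_apply]
    constructor <;> intro h <;> linarith
  rw [hset]
  refine hcher.trans ?_
  have h1 := hT.mgf_le hX hXlaw s
  have h2 := hS.mgf_le hZ hZlaw s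
  calc _ ≤ Real.exp (-s * ε) * (Real.exp (n * cT ^ 2 * s ^ 2 / 8) *
        Real.exp (m * cS ^ 2 * s ^ 2 / 8)) := by
        gcongr
        exact mgf_nonneg
    _ = Real.exp (-(2 * ε ^ 2 / V)) := by
        rw [← Real.exp_add, ← Real.exp_add]
        congr 1
        rw [← add_div, ← add_mul, ← hV, hs]
        field_simp
        ring

/-! ### Divergences as real numbers -/

theorem coe_ciSup_eq {ι : Type*} [Nonempty ι] {u : ι → ℝ} (hu : BddAbove (range u)) :
    ⨆ i, ((u i : ℝ) : EReal) = ((⨆ i, u i : ℝ) : EReal) := by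
  refine le_antisymm (iSup_le fun i => EReal.coe_le_coe_iff.2 (le_ciSup hu i)) ?_
  obtain ⟨i₀⟩ := id ‹Nonempty ι›
  rcases eq_or_ne (⨆ i, ((u i : ℝ) : EReal)) ⊤ with h | h
  · rw [h]; exact le_top
  have hb : ⨆ i, ((u i : ℝ) : EReal) ≠ ⊥ :=
    ((EReal.bot_lt_coe _).trans_le (le_iSup (fun i => ((u i : ℝ) : EReal)) i₀)).ne'
  rw [← EReal.coe_toReal h hb, EReal.coe_le_coe_iff]
  refine ciSup_le fun i => ?_
  rw [← EReal.coe_le_coe_iff, EReal.coe_toReal h hb]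
  exact le_iSup (fun i => ((u i : ℝ) : EReal)) i

theorem coe_ciInf_eq {ι : Type*} [Nonempty ι] {u : ι → ℝ} (hu : BddBelow (range u)) :
    ⨅ i, ((u i : ℝ) : EReal) = ((⨅ i, u i : ℝ) : EReal) := by
  refine le_antisymm ?_ (le_iInf fun i => EReal.coe_le_coe_iff.2 (ciInf_le hu i))
  obtain ⟨i₀⟩ := id ‹Nonempty ι›
  rcases eq_or_ne (⨅ i, ((u i : ℝ) : EReal)) ⊥ with h | h
  · rw [h]; exact bot_le
  have ht : ⨅ i, ((u i : ℝ) : EReal) ≠ ⊤ :=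
    ((iInf_le (fun i => ((u i : ℝ) : EReal)) i₀).trans_lt (EReal.coe_lt_top _)).ne
  rw [← EReal.coe_toReal ht h, EReal.coe_le_coe_iff]
  refine le_ciInf fun i => ?_
  rw [← EReal.coe_le_coe_iff, EReal.coe_toReal ht h]
  exact iInf_le (fun i => ((u i : ℝ) : EReal)) i

/-- The objective `E_P[h] - Λ^Q[h]`. -/
noncomputable def gap {X : Type*} [MeasurableSpace X] (F : ℝ → ℝ) (z₀ α β : ℝ) (P Q : Measure X)
    (h : X → ℝ) : ℝ := ∫ x, h x ∂P - cumul F z₀ α β Q h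

/-- The real-valued version of the divergence. -/
noncomputable def realDiv {X : Type*} [MeasurableSpace X] (F : ℝ → ℝ) (z₀ α β : ℝ)
    (Γ : Set (X → ℝ)) (P Q : Measure X) : ℝ := ⨆ h : Γ, gap F z₀ α β P Q h

section Divergence

variable {X : Type*} [MeasurableSpace X] {P Q : Measure X} [IsProbabilityMeasure P]
  [IsProbabilityMeasure Q] {F : ℝ → ℝ} {z₀ w α β : ℝ} {Γ Γt : Set (X → ℝ)}

theorem IsConjugate.abs_gap_le (hF : IsConjugate F z₀ w) (hαβ : α < β) (hw : z₀ + (β - α) < w)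
    {h : X → ℝ} (hh : Measurable h) (hb : ∀ x, α ≤ h x ∧ h x ≤ β) :
    |gap F z₀ α β P Q h| ≤ β - α := by
  have h1 := le_integral_of_bdd (P := P) hh hb
  have h2 := hF.cumul_mem_Icc (P := Q) hαβ hw hh hb
  rw [gap, abs_le]
  constructor <;> linarith [h1.1, h1.2, h2.1, h2.2]

theorem IsConjugate.bddAbove_gap (hF : IsConjugate F z₀ w) (hαβ : α < β)
    (hw : z₀ + (β - α) < w) (hΓm : ∀ h ∈ Γ, Measurable h)
    (hΓb : ∀ h ∈ Γ, ∀ x, α ≤ h x ∧ h x ≤ β) :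
    BddAbove (range fun h : Γ => gap F z₀ α β P Q h) :=
  bddAbove_range_of_abs_le fun h => hF.abs_gap_le hαβ hw (hΓm h h.2) (hΓb h h.2)

theorem IsConjugate.gap_le_realDiv (hF : IsConjugate F z₀ w) (hαβ : α < β)
    (hw : z₀ + (β - α) < w) (hΓm : ∀ h ∈ Γ, Measurable h)
    (hΓb : ∀ h ∈ Γ, ∀ x, α ≤ h x ∧ h x ≤ β) {h : X → ℝ} (hh : h ∈ Γ) :
    gap F z₀ α β P Q h ≤ realDiv F z₀ α β Γ P Q :=
  le_ciSup (hF.bddAbove_gap hαβ hw hΓm hΓb) (⟨h, hh⟩ : Γ)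

theorem IsConjugate.abs_realDiv_le (hF : IsConjugate F z₀ w) (hαβ : α < β)
    (hw : z₀ + (β - α) < w) (hΓm : ∀ h ∈ Γ, Measurable h)
    (hΓb : ∀ h ∈ Γ, ∀ x, α ≤ h x ∧ h x ≤ β) (hΓ : Γ.Nonempty) :
    |realDiv F z₀ α β Γ P Q| ≤ β - α := by
  have := hΓ.to_subtype
  exact abs_ciSup_le fun h : Γ => hF.abs_gap_le hαβ hw (hΓm h h.2) (hΓb h h.2)

theorem IsF1.divergence_eq {a : ℝ} {b : EReal} {f : ℝ → ℝ} (hf : IsF1 a b f) (hαβ : α < β)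
    (hw : zZero f + (β - α) < w) (hfin : legendre a b f w < ⊤) (hΓm : ∀ h ∈ Γ, Measurable h)
    (hΓb : ∀ h ∈ Γ, ∀ x, α ≤ h x ∧ h x ≤ β) (hΓ : Γ.Nonempty) :
    divergence a b f Γ P Q = (realDiv (conj a b f) (zZero f) α β Γ P Q : ℝ) := by
  have hF := hf.isConjugate hfin (by linarith)
  have := hΓ.to_subtype
  unfold divergence realDiv
  rw [iSup_subtype', ← coe_ciSup_eq (hF.bddAbove_gap hαβ hw hΓm hΓb)]
  congr 1
  ext h
  rw [hf.cumulant_eq hαβ hw hfin (hΓm h h.2) (hΓb h h.2), ← EReal.coe_sub]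
  rfl

theorem IsConjugate.realDiv_mono (hF : IsConjugate F z₀ w) (hαβ : α < β)
    (hw : z₀ + (β - α) < w) (hΓm : ∀ h ∈ Γ, Measurable h)
    (hΓb : ∀ h ∈ Γ, ∀ x, α ≤ h x ∧ h x ≤ β) (hΓt : Γt.Nonempty) (hsub : Γt ⊆ Γ) :
    realDiv F z₀ α β Γt P Q ≤ realDiv F z₀ α β Γ P Q := by
  have := hΓt.to_subtype
  exact ciSup_le fun h : Γt => hF.gap_le_realDiv hαβ hw hΓm hΓb (hsub h.2)

/-- Replacing h by a uniformly close h' changes the mean with factor 1 and the cumulant with factor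
the right derivative of F at the end of the window. -/
theorem IsConjugate.realDiv_le_add_approx (hF : IsConjugate F z₀ w) (hαβ : α < β)
    (hw : z₀ + (β - α) < w) (hΓm : ∀ h ∈ Γ, Measurable h)
    (hΓb : ∀ h ∈ Γ, ∀ x, α ≤ h x ∧ h x ≤ β) (hΓt : Γt.Nonempty) (hsub : Γt ⊆ Γ) :
    realDiv F z₀ α β Γ P Q ≤ realDiv F z₀ α β Γt P Q + (1 + rightDeriv F (z₀ + (β - α))) *
      ⨆ h : Γ, ⨅ h' : Γt, ⨆ x : X, |(h : X → ℝ) x - (h' : X → ℝ) x| := by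
  have := (hΓt.mono hsub).to_subtype
  have := hΓt.to_subtype
  have hD := hF.one_le_rightDeriv (x := z₀ + (β - α)) (by linarith) hw
  set D := rightDeriv F (z₀ + (β - α))
  set A := ⨆ h : Γ, ⨅ h' : Γt, ⨆ x : X, |(h : X → ℝ) x - (h' : X → ℝ) x|
  have habs : ∀ (h : Γ) (h' : Γt) (x : X), |(h : X → ℝ) x - (h' : X → ℝ) x| ≤ β - α :=
    fun h h' x => by
      have h1 := hΓb h h.2 x
      have h2 := hΓb h' (hsub h'.2) x
      rw [abs_le]
      constructor <;> linarith [h1.1, h1.2, h2.1, h2.2]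
  have hbelow : ∀ h : Γ, BddBelow (range fun h' : Γt => ⨆ x : X, |(h : X → ℝ) x - (h' : X → ℝ) x|) :=
    fun h => ⟨0, by rintro _ ⟨h', rfl⟩; exact Real.iSup_nonneg fun x => abs_nonneg _⟩
  have habove : BddAbove (range fun h : Γ => ⨅ h' : Γt, ⨆ x : X,
      |(h : X → ℝ) x - (h' : X → ℝ) x|) := by
    obtain ⟨h', hh'⟩ := id hΓt
    refine ⟨β - α, ?_⟩
    rintro _ ⟨h, rfl⟩
    exact (ciInf_le (hbelow h) ⟨h', hh'⟩).trans
      (Real.iSup_le (fun x => habs h ⟨h', hh'⟩ x) (by linarith))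
  refine ciSup_le fun h => le_of_forall_pos_le_add fun ε hε => ?_
  -- The infimum over h' need not be attained; the slack ε / (1 + D) becomes ε after multiplication
  -- by 1 + D.
  have hlt : ⨅ h' : Γt, ⨆ x : X, |(h : X → ℝ) x - (h' : X → ℝ) x| < A + ε / (1 + D) :=
    (le_ciSup habove h).trans_lt (lt_add_of_pos_right _ (by positivity))
  obtain ⟨h', hh'⟩ := exists_lt_of_ciInf_lt hlt
  have hpt : ∀ x, |(h : X → ℝ) x - (h' : X → ℝ) x| ≤ A + ε / (1 + D) := fun x =>
    (le_ciSup (f := fun x => |(h : X → ℝ) x - (h' : X → ℝ) x|)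
      ⟨β - α, by rintro _ ⟨x, rfl⟩; exact habs h h' x⟩ x).trans hh'.le
  have hm := hΓm h h.2
  have hm' := hΓm h' (hsub h'.2)
  have hb := hΓb h h.2
  have hb' := hΓb h' (hsub h'.2)
  have hint : ∀ (M : Measure X) [IsProbabilityMeasure M],
      Integrable (h : X → ℝ) M ∧ Integrable (h' : X → ℝ) M := fun M _ =>
    ⟨Integrable.of_mem_Icc α β hm.aemeasurable (ae_of_all _ hb),
      Integrable.of_mem_Icc α β hm'.aemeasurable (ae_of_all _ hb')⟩
  have hI : ∀ (M : Measure X) [IsProbabilityMeasure M],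
      ∫ x, |(h : X → ℝ) x - (h' : X → ℝ) x| ∂M ≤ A + ε / (1 + D) := fun M _ => by
    refine (integral_mono ((hint M).1.sub (hint M).2).abs (integrable_const _) hpt).trans ?_
    simp
  have h1 : ∫ x, (h : X → ℝ) x ∂P ≤ ∫ x, (h' : X → ℝ) x ∂P + (A + ε / (1 + D)) := by
    rw [← sub_le_iff_le_add', ← integral_sub (hint P).1 (hint P).2]
    refine (integral_mono ((hint P).1.sub (hint P).2) ((hint P).1.sub (hint P).2).abs
      fun x => le_abs_self _).trans (hI P)
  have h2 := hF.cumul_le_add (P := Q) hαβ hw hm' hb' hm hb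
  simp_rw [abs_sub_comm ((h' : X → ℝ) _)] at h2
  have h3 := mul_le_mul_of_nonneg_left (hI Q) (by linarith : 0 ≤ D)
  have h4 := hF.gap_le_realDiv (P := P) (Q := Q) hαβ hw (fun g hg => hΓm g (hsub hg))
    (fun g hg => hΓb g (hsub hg)) h'.2
  have h5 : (1 + D) * (A + ε / (1 + D)) = (1 + D) * A + ε := by field_simp
  unfold gap at h4 ⊢
  linarith

end Divergence

/-! ### Limits -/

section Limits

variable {X : Type*} [MeasurableSpace X] {P : Measure X} [IsProbabilityMeasure P]
  {F : ℝ → ℝ} {z₀ w α β : ℝ} {u : ℕ → X → ℝ} {h : X → ℝ}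

theorem tendsto_integral_of_bdd (hum : ∀ j, Measurable (u j))
    (hub : ∀ j x, α ≤ u j x ∧ u j x ≤ β)
    (hlim : ∀ x, Tendsto (fun j => u j x) atTop (𝓝 (h x))) :
    Tendsto (fun j => ∫ x, u j x ∂P) atTop (𝓝 (∫ x, h x ∂P)) :=
  tendsto_integral_of_dominated_convergence (fun _ => max |α| |β|)
    (fun j => (hum j).aestronglyMeasurable) (integrable_const _)
    (fun j => ae_of_all _ fun x => abs_le_max_abs_abs (hub j x).1 (hub j x).2)
    (ae_of_all _ hlim)

theorem IsConjugate.tendsto_cumul (hF : IsConjugate F z₀ w) (hαβ : α < β)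
    (hw : z₀ + (β - α) < w) (hum : ∀ j, Measurable (u j))
    (hub : ∀ j x, α ≤ u j x ∧ u j x ≤ β) (hh : Measurable h) (hb : ∀ x, α ≤ h x ∧ h x ≤ β)
    (hlim : ∀ x, Tendsto (fun j => u j x) atTop (𝓝 (h x))) :
    Tendsto (fun j => cumul F z₀ α β P (u j)) atTop (𝓝 (cumul F z₀ α β P h)) := by
  have h0 : Tendsto (fun j => ∫ x, |u j x - h x| ∂P) atTop (𝓝 (∫ _, (0 : ℝ) ∂P)) := by
    refine tendsto_integral_of_bdd (α := 0) (β := β - α) (fun j => ((hum j).sub hh).abs)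
      (fun j x => ⟨abs_nonneg _, ?_⟩) fun x => ?_
    · rw [abs_le]
      constructor <;> linarith [(hub j x).1, (hub j x).2, (hb x).1, (hb x).2]
    · have := ((hlim x).sub_const (h x)).abs
      simpa using this
  rw [integral_zero] at h0
  have h1 := h0.const_mul (rightDeriv F (z₀ + (β - α)))
  rw [mul_zero] at h1
  rw [tendsto_iff_dist_tendsto_zero]
  refine squeeze_zero (fun j => dist_nonneg) (fun j => ?_) h1
  rw [Real.dist_eq]
  exact hF.abs_cumul_sub_le hαβ hw (hum j) (hub j) hh hb

end Limits

/-! ### Deviations of empirical means and cumulants -/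

section Deviations

theorem avg_sub_avg_le {Y : Type*} {k : ℕ} {α β : ℝ} {ψ : Y → ℝ}
    (hψ : ∀ y, α ≤ ψ y ∧ ψ y ≤ β) {j : Fin k} {x x' : Fin k → Y} (hx : ∀ j' ≠ j, x j' = x' j') :
    (1 / (k : ℝ)) * ∑ j, ψ (x j) - (1 / (k : ℝ)) * ∑ j, ψ (x' j) ≤ (β - α) / k := by
  rw [← mul_sub, ← Finset.sum_sub_distrib, Finset.sum_eq_single j
    (fun j' _ hj' => by rw [hx j' hj', sub_self]) (by simp), one_div_mul_eq_div]
  exact div_le_div_of_nonneg_right (by linarith [(hψ (x j)).2, (hψ (x' j)).1]) (Nat.cast_nonneg k)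

variable {ι : Type*} [Countable ι] [Nonempty ι]

theorem hasBoundedDiff_mean {Y : Type*} [MeasurableSpace Y] {P : Measure Y}
    [IsProbabilityMeasure P] {k : ℕ} {α β : ℝ} {ψ : ι → Y → ℝ} (hψm : ∀ i, Measurable (ψ i))
    (hψ : ∀ i y, α ≤ ψ i y ∧ ψ i y ≤ β) :
    HasBoundedDiff (fun x : Fin k → Y => ⨆ i, ((1 / (k : ℝ)) * ∑ j, ψ i (x j) - ∫ y, ψ i y ∂P))
        ((β - α) / k) ∧
      HasBoundedDiff (fun x : Fin k → Y => ⨆ i, (∫ y, ψ i y ∂P - (1 / (k : ℝ)) * ∑ j, ψ i (x j)))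
        ((β - α) / k) := by
  have hm : ∀ i, Measurable fun x : Fin k → Y => (1 / (k : ℝ)) * ∑ j, ψ i (x j) := fun i => by
    have := hψm i
    fun_prop
  set C := max |α| |β|
  have hC0 : 0 ≤ C := (abs_nonneg _).trans (le_max_left _ _)
  have hψC : ∀ i y, |ψ i y| ≤ C := fun i y => abs_le_max_abs_abs (hψ i y).1 (hψ i y).2
  have hb : ∀ i (x : Fin k → Y), |(1 / (k : ℝ)) * ∑ j, ψ i (x j)| ≤ C := fun i x => by
    have := abs_avg_signSum_le (fun _ : Fin k => 1) hC0 (v := fun j => ψ i (x j)) fun j => hψC i _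
    simpa [signSum] using this
  have hb' : ∀ i, |∫ y, ψ i y ∂P| ≤ C := fun i =>
    abs_le_max_abs_abs (le_integral_of_bdd (hψm i) (hψ i)).1 (le_integral_of_bdd (hψm i) (hψ i)).2
  constructor
  · refine HasBoundedDiff.ciSup (fun i => (hm i).sub_const _) (C := C + C)
      (fun i x => (abs_sub _ _).trans (add_le_add (hb i x) (hb' i))) fun i j x x' hx => ?_
    have := avg_sub_avg_le (hψ i) hx
    linarith
  · refine HasBoundedDiff.ciSup (fun i => measurable_const.sub (hm i)) (C := C + C)
      (fun i x => (abs_sub _ _).trans (add_le_add (hb' i) (hb i x))) fun i j x x' hx => ?_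
    have := avg_sub_avg_le (hψ i) (x := x') (x' := x) fun j' hj' => (hx j' hj').symm
    linarith

variable {X : Type*} [MeasurableSpace X] {Q : Measure X} [IsProbabilityMeasure Q]
  {F : ℝ → ℝ} {z₀ w α β : ℝ} {H : ι → X → ℝ} {n : ℕ}

/-- The condition on c says that c dominates every lower bound of the one-point estimates over z, so
that c may be taken as their infimum. -/
theorem IsConjugate.hasBoundedDiff_cumul (hF : IsConjugate F z₀ w) (hαβ : α < β)
    (hw : z₀ + (β - α) < w) (hHm : ∀ i, Measurable (H i)) (hH : ∀ i x, α ≤ H i x ∧ H i x ≤ β)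
    (hn : 0 < n) {c : ℝ} (hc : ∀ d, (∀ z ∈ Icc (z₀ - (β - α)) z₀,
      d ≤ -z + ((n : ℝ) - 1) / n * F z + 1 / (n : ℝ) * F (β - α + z)) → d ≤ c) :
    HasBoundedDiff (fun x : Fin n → X =>
        ⨆ i, (cumul F z₀ α β (empirical x) (H i) - cumul F z₀ α β Q (H i))) c ∧
      HasBoundedDiff (fun x : Fin n → X =>
        ⨆ i, (cumul F z₀ α β Q (H i) - cumul F z₀ α β (empirical x) (H i))) c := by
  have hm : ∀ i, Measurable fun x : Fin n → X => cumul F z₀ α β (empirical x) (H i) := fun i =>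
    hF.measurable_cumul_empirical hαβ hw (hHm i) (hH i) hn
  have hQ : ∀ i, cumul F z₀ α β Q (H i) ∈ Icc α β := fun i =>
    hF.cumul_mem_Icc hαβ hw (hHm i) (hH i)
  have hx : ∀ i (x : Fin n → X), cumul F z₀ α β (empirical x) (H i) ∈ Icc α β := fun i x => by
    have := isProbabilityMeasure_empirical hn x
    exact hF.cumul_mem_Icc hαβ hw (hHm i) (hH i)
  have hdiff : ∀ i j (x x' : Fin n → X), (∀ j' ≠ j, x j' = x' j') →
      cumul F z₀ α β (empirical x) (H i) - cumul F z₀ α β (empirical x') (H i) ≤ c :=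
    fun i j x x' hxx' => hc _ fun z hz =>
      hF.cumul_empirical_sub_le hαβ hw (hHm i) (hH i) hn hxx' hz
  constructor
  · refine HasBoundedDiff.ciSup (fun i => (hm i).sub_const _) (C := β - α) (fun i x => ?_)
      fun i j x x' hxx' => by linarith [hdiff i j x x' hxx']
    rw [abs_le]
    constructor <;> linarith [(hQ i).1, (hQ i).2, (hx i x).1, (hx i x).2]
  · refine HasBoundedDiff.ciSup (fun i => measurable_const.sub (hm i)) (C := β - α) (fun i x => ?_)
      fun i j x x' hxx' => by linarith [hdiff i j x' x fun j' hj' => (hxx' j' hj').symm]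
    rw [abs_le]
    constructor <;> linarith [(hQ i).1, (hQ i).2, (hx i x).1, (hx i x).2]

/-- A difference of infima over the shift is at most the supremum of the differences, which is a
uniform deviation of means over the family indexed by pairs (i, shift). After symmetrization, F (H -
ν) splits into a linear part with coefficient e and an ℓ-Lipschitz remainder. Contraction replaces
the remainder by ℓ (H - ν), and the shift costs its radius (β - α) / 2 divided by √n. -/
theorem IsConjugate.integral_ciSup_cumul_sub_le (hF : IsConjugate F z₀ w) (hαβ : α < β)
    (hw : z₀ + (β - α) < w) (hHm : ∀ i, Measurable (H i)) (hH : ∀ i x, α ≤ H i x ∧ H i x ≤ β)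
    (hn : 0 < n) {e ℓ : ℝ} (he : 0 ≤ e) (hℓ : 0 ≤ ℓ)
    (hφ : ∀ x ∈ Icc (z₀ - (β - α)) (z₀ + (β - α)), ∀ y ∈ Icc (z₀ - (β - α)) (z₀ + (β - α)),
      |(F x - e * x) - (F y - e * y)| ≤ ℓ * |x - y|) :
    ∫ x, (⨆ i, (cumul F z₀ α β (empirical x) (H i) - cumul F z₀ α β Q (H i)))
        ∂(Measure.pi fun _ : Fin n => Q) ≤
      2 * ((e + ℓ) * ∫ x, signAvg (fun i j => H i (x j)) ∂(Measure.pi fun _ : Fin n => Q) +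
        ℓ * ((β - α) / 2 / √(n : ℝ))) ∧
    ∫ x, (⨆ i, (cumul F z₀ α β Q (H i) - cumul F z₀ α β (empirical x) (H i)))
        ∂(Measure.pi fun _ : Fin n => Q) ≤
      2 * ((e + ℓ) * ∫ x, signAvg (fun i j => H i (x j)) ∂(Measure.pi fun _ : Fin n => Q) +
        ℓ * ((β - α) / 2 / √(n : ℝ))) := by
  have : Nonempty (Icc (α - z₀) (β - z₀)) := ⟨⟨α - z₀, by simp [hαβ.le]⟩⟩
  let ν : ℕ → ℝ := fun k => TopologicalSpace.denseSeq (Icc (α - z₀) (β - z₀)) k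
  have hν : ∀ k, ν k ∈ Icc (α - z₀) (β - z₀) := fun k =>
    (TopologicalSpace.denseSeq (Icc (α - z₀) (β - z₀)) k).2
  have hsub : ∀ i k x, H i x - ν k ∈ Icc (z₀ - (β - α)) (z₀ + (β - α)) := fun i k x =>
    sub_mem_Icc (hH i x) (hν k)
  -- the centred objective, up to a constant
  let φ : ι × ℕ → X → ℝ := fun q x => F (H q.1 x - ν q.2) - e * (H q.1 x - ν q.2)
  -- This equals F (H - ν) + e ν. The constant e ν cancels in differences of means, and it makes the
  -- linear part e H free of the shift.
  let ψ : ι × ℕ → X → ℝ := fun q x => e * H q.1 x + φ q x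
  set CH := max |α| |β|
  set Cs := max |z₀ - (β - α)| |z₀ + (β - α)|
  set CF := max |F (z₀ - (β - α))| |F (z₀ + (β - α))|
  have hCH : ∀ i x, |H i x| ≤ CH := fun i x => abs_le_max_abs_abs (hH i x).1 (hH i x).2
  have hCs : ∀ i k x, |H i x - ν k| ≤ Cs := fun i k x =>
    abs_le_max_abs_abs (hsub i k x).1 (hsub i k x).2
  have hCF : ∀ i k x, |F (H i x - ν k)| ≤ CF := fun i k x =>
    abs_le_max_abs_abs (hF.mem_Icc hw (hsub i k x)).1 (hF.mem_Icc hw (hsub i k x)).2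
  have hCH0 : 0 ≤ CH := (abs_nonneg _).trans (le_max_left _ _)
  have hCs0 : 0 ≤ Cs := (abs_nonneg _).trans (le_max_left _ _)
  have hCF0 : 0 ≤ CF := (abs_nonneg _).trans (le_max_left _ _)
  have hφb : ∀ q x, |φ q x| ≤ CF + e * Cs := fun q x => by
    refine (abs_sub _ _).trans (add_le_add (hCF _ _ _) ?_)
    rw [abs_mul, abs_of_nonneg he]
    exact mul_le_mul_of_nonneg_left (hCs _ _ _) he
  have hψb : ∀ q x, |ψ q x| ≤ e * CH + (CF + e * Cs) := fun q x => by
    refine (abs_add_le _ _).trans (add_le_add ?_ (hφb q x))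
    rw [abs_mul, abs_of_nonneg he]
    exact mul_le_mul_of_nonneg_left (hCH _ _) he
  have hψm : ∀ q, Measurable (ψ q) := fun q => by
    have := hHm q.1
    have := hF.measurable
    fun_prop
  have hobj : ∀ (P : Measure X) [IsProbabilityMeasure P] q,
      ∫ x, ψ q x ∂P = cumulObj F P (H q.1) (ν q.2) + (e - 1) * ν q.2 := fun P _ q => by
    have : ψ q = fun x => F (H q.1 x - ν q.2) + e * ν q.2 := by
      funext x
      simp only [ψ, φ]
      ring
    rw [this, integral_add (hF.integrable_sub hw (hHm q.1) (hH q.1) (hν q.2))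
      (integrable_const _), cumulObj]
    simp only [integral_const, probReal_univ, one_smul]
    ring
  have hinf : ∀ (P : Measure X) [IsProbabilityMeasure P] i,
      cumul F z₀ α β P (H i) = ⨅ k, cumulObj F P (H i) (ν k) := fun P _ i =>
    ciInf_denseSeq (hF.continuous_cumulObj hw (hHm i) (hH i))
      (hF.bddBelow_cumulObj hw (hHm i) (hH i))
  have hle : ∀ (P P' : Measure X) [IsProbabilityMeasure P] [IsProbabilityMeasure P'] (s : ℝ),
      (∀ q, ∫ x, ψ q x ∂P - ∫ x, ψ q x ∂P' ≤ s) →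
      ∀ i, cumul F z₀ α β P (H i) - cumul F z₀ α β P' (H i) ≤ s := fun P P' _ _ s hs i => by
    rw [sub_le_comm, hinf P' i]
    refine le_ciInf fun k => ?_
    have h1 := hs (i, k)
    rw [hobj, hobj] at h1
    have h2 := hF.cumul_le (P := P) hw (hHm i) (hH i) (hν k)
    linarith
  have hemp : ∀ q (x : Fin n → X), ∫ y, ψ q y ∂(empirical x) = (1 / (n : ℝ)) * ∑ j, ψ q (x j) :=
    fun q x => integral_empirical x (hψm q)
  set π := Measure.pi fun _ : Fin n => Q
  have hsign : ∀ x : Fin n → X, signAvg (fun q j => ψ q (x j)) ≤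
      (e + ℓ) * signAvg (fun i j => H i (x j)) + ℓ * ((β - α) / 2 / √(n : ℝ)) := fun x => by
    have h1 : signAvg (fun q j => ψ q (x j)) ≤
        signAvg (fun (q : ι × ℕ) j => e * H q.1 (x j)) + signAvg (fun q j => φ q (x j)) :=
      signAvg_add_le (C := e * CH + (CF + e * Cs)) (by positivity)
        (fun q j => by
          rw [abs_mul, abs_of_nonneg he]
          have := mul_le_mul_of_nonneg_left (hCH q.1 (x j)) he
          have : 0 ≤ CF + e * Cs := by positivity
          linarith)
        fun q j => (hφb q _).trans (le_add_of_nonneg_left (by positivity))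
    rw [signAvg_const_mul he] at h1
    have h2 : signAvg (fun (q : ι × ℕ) j => H q.1 (x j)) ≤ signAvg (fun i j => H i (x j)) :=
      signAvg_comp_le (v := fun i j => H i (x j)) hCH0 (fun i j => hCH i _) Prod.fst
    have h3 : signAvg (fun q j => φ q (x j)) ≤
        signAvg (fun (q : ι × ℕ) j => ℓ * (H q.1 (x j) - ν q.2)) :=
      signAvg_mono_of_abs_sub_le (C := ℓ * Cs + (CF + e * Cs))
        (fun q j => by
          rw [abs_mul, abs_of_nonneg hℓ]
          have := mul_le_mul_of_nonneg_left (hCs q.1 q.2 (x j)) hℓ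
          have : 0 ≤ CF + e * Cs := by positivity
          linarith)
        (fun q j => (hφb q _).trans (le_add_of_nonneg_left (by positivity))) (by positivity)
        fun j q q' => by
          rw [← mul_sub, abs_mul, abs_of_nonneg hℓ]
          exact hφ _ (hsub _ _ _) _ (hsub _ _ _)
    rw [signAvg_const_mul hℓ] at h3
    have h4 : signAvg (fun (q : ι × ℕ) j => H q.1 (x j) - ν q.2) ≤
        signAvg (fun i j => H i (x j)) + (β - α) / 2 / √(n : ℝ) :=
      signAvg_sub_le hn (v := fun i j => H i (x j)) hCH0 (fun i j => hCH i _)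
        (c := (α + β) / 2 - z₀) fun k => by
          rw [abs_le]
          constructor <;> linarith [(hν k).1, (hν k).2]
    have h5 := mul_le_mul_of_nonneg_left h2 he
    have h6 := mul_le_mul_of_nonneg_left h4 hℓ
    linarith
  have hsi : Integrable (fun x : Fin n → X => signAvg fun i j => H i (x j)) π :=
    integrable_of_abs_le (measurable_signAvg_comp hHm)
      fun x => abs_signAvg_le hCH0 fun i j => hCH i _
  have hsψ : Integrable (fun x : Fin n → X => signAvg fun q j => ψ q (x j)) π :=
    integrable_of_abs_le (measurable_signAvg_comp hψm)
      fun x => abs_signAvg_le (by positivity) fun q j => hψb q _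
  have hR : ∫ x, signAvg (fun q j => ψ q (x j)) ∂π ≤
      (e + ℓ) * ∫ x, signAvg (fun i j => H i (x j)) ∂π + ℓ * ((β - α) / 2 / √(n : ℝ)) := by
    refine (integral_mono hsψ ((hsi.const_mul _).add (integrable_const _)) hsign).trans ?_
    simp only [Pi.add_apply]
    rw [integral_add (hsi.const_mul _) (integrable_const _), integral_const_mul]
    simp
  -- Used only for integrability, so the estimate at the single point z = z₀ suffices as constant.
  have hbd := hF.hasBoundedDiff_cumul (Q := Q) hαβ hw hHm hH hn fun d hd => hd z₀ ⟨by linarith, le_rfl⟩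
  have hmb := hasBoundedDiff_mean (P := Q) (k := n) hψm (α := -(e * CH + (CF + e * Cs)))
    (β := e * CH + (CF + e * Cs)) fun q x => abs_le.1 (hψb q x)
  have hbdd : ∀ (x : Fin n → X) q, |(1 / (n : ℝ)) * ∑ j, ψ q (x j) - ∫ y, ψ q y ∂Q| ≤
      (e * CH + (CF + e * Cs)) + (e * CH + (CF + e * Cs)) := fun x q => by
    have := isProbabilityMeasure_empirical hn x
    rw [← hemp]
    have h1 : ∀ (P : Measure X) [IsProbabilityMeasure P],
        |∫ y, ψ q y ∂P| ≤ e * CH + (CF + e * Cs) := fun P _ =>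
      abs_le.2 (le_integral_of_bdd (hψm q) fun y => abs_le.1 (hψb q y))
    exact (abs_sub _ _).trans (add_le_add (h1 _) (h1 _))
  constructor
  · refine le_trans (integral_mono (hbd.1.integrable π) (hmb.1.integrable π) fun x => ?_)
      ((integral_ciSup_avg_sub_le hn hψm hψb).trans (mul_le_mul_of_nonneg_left hR zero_le_two))
    have := isProbabilityMeasure_empirical hn x
    refine ciSup_le fun i => hle _ _ _ (fun q => ?_) i
    rw [hemp]
    exact le_ciSup (f := fun q => (1 / (n : ℝ)) * ∑ j, ψ q (x j) - ∫ y, ψ q y ∂Q)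
      (bddAbove_range_of_abs_le (hbdd x)) q
  · refine le_trans (integral_mono (hbd.2.integrable π) (hmb.2.integrable π) fun x => ?_)
      ((integral_ciSup_sub_avg_le hn hψm hψb).trans (mul_le_mul_of_nonneg_left hR zero_le_two))
    have := isProbabilityMeasure_empirical hn x
    refine ciSup_le fun i => hle _ _ _ (fun q => ?_) i
    rw [hemp]
    exact le_ciSup (f := fun q => ∫ y, ψ q y ∂Q - (1 / (n : ℝ)) * ∑ j, ψ q (x j))
      (bddAbove_range_of_abs_le fun q => by rw [abs_sub_comm]; exact hbdd x q) q

end Deviations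

/-! ### Reduction of Rademacher complexities to countable families -/

section Separable

variable {X Z Θ : Type*} {Γt Γ₀ : Set (X → ℝ)} {α β : ℝ}

theorem rademacher_eq_integral_signAvg [MeasurableSpace X] {Q : Measure X} {n : ℕ}
    (hne : Γt.Nonempty) (hne₀ : Γ₀.Nonempty)
    (hb : ∀ h ∈ Γt, ∀ x, α ≤ h x ∧ h x ≤ β) (hsub : Γ₀ ⊆ Γt)
    (hlim : ∀ h ∈ Γt, ∃ u : ℕ → X → ℝ,
      (∀ j, u j ∈ Γ₀) ∧ ∀ x, Tendsto (fun j => u j x) atTop (𝓝 (h x))) :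
    rademacher Γt Q n =
      ∫ x, signAvg (fun (h : Γ₀) j => (h : X → ℝ) (x j)) ∂(Measure.pi fun _ : Fin n => Q) := by
  have := hne.to_subtype
  have := hne₀.to_subtype
  unfold rademacher
  congr 1
  funext x
  rw [empRademacher_eq]
  refine signAvg_eq_of_mem_closure (C := max |α| |β|) ((abs_nonneg _).trans (le_max_left _ _))
    (v := fun (h : Γt) j => (h : X → ℝ) (x j)) (g := fun h : Γ₀ => (⟨h, hsub h.2⟩ : Γt))
    (fun h j => abs_le_max_abs_abs (hb h h.2 _).1 (hb h h.2 _).2) fun h => ?_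
  obtain ⟨u, hu, hlim⟩ := hlim h h.2
  exact mem_closure_of_tendsto (tendsto_pi_nhds.2 fun j => hlim (x j))
    (Eventually.of_forall fun k => ⟨⟨u k, hu k⟩, rfl⟩)

theorem rademacher_compFamily_eq_integral_signAvg [TopologicalSpace X] [TopologicalSpace Θ]
    [TopologicalSpace.SeparableSpace Θ] [Nonempty Θ] [MeasurableSpace Z] {PZ : Measure Z} {m : ℕ}
    {Φ : Θ → Z → X} (hΦ : ∀ z, Continuous fun θ => Φ θ z)
    (hne : Γt.Nonempty) (hne₀ : Γ₀.Nonempty) (hcont : ∀ h ∈ Γt, Continuous h)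
    (hb : ∀ h ∈ Γt, ∀ x, α ≤ h x ∧ h x ≤ β) (hsub : Γ₀ ⊆ Γt)
    (hlim : ∀ h ∈ Γt, ∃ u : ℕ → X → ℝ,
      (∀ j, u j ∈ Γ₀) ∧ ∀ x, Tendsto (fun j => u j x) atTop (𝓝 (h x))) :
    rademacher (compFamily Γt Φ) PZ m =
      ∫ z, signAvg (fun (q : Γ₀ × ℕ) j =>
        (q.1 : X → ℝ) (Φ (TopologicalSpace.denseSeq Θ q.2) (z j)))
        ∂(Measure.pi fun _ : Fin m => PZ) := by
  obtain ⟨h₀, hh₀⟩ := id hne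
  obtain ⟨θ₀⟩ := id ‹Nonempty Θ›
  have : Nonempty (compFamily Γt Φ) := ⟨⟨_, h₀, hh₀, θ₀, rfl⟩⟩
  have := hne₀.to_subtype
  unfold rademacher
  congr 1
  funext z
  rw [empRademacher_eq]
  refine signAvg_eq_of_mem_closure (C := max |α| |β|) ((abs_nonneg _).trans (le_max_left _ _))
    (v := fun (ψ : compFamily Γt Φ) j => (ψ : Z → ℝ) (z j))
    (g := fun q : Γ₀ × ℕ => (⟨(q.1 : X → ℝ) ∘ Φ (TopologicalSpace.denseSeq Θ q.2), q.1,
      hsub q.1.2, _, rfl⟩ : compFamily Γt Φ)) ?_ ?_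
  · rintro ⟨_, h, hh, θ, rfl⟩ j
    exact abs_le_max_abs_abs (hb h hh _).1 (hb h hh _).2
  · rintro ⟨_, h, hh, θ, rfl⟩
    obtain ⟨u, hu, hlim⟩ := hlim h hh
    -- Two successive limits: first in h along the approximating sequence, then in θ along the dense
    -- sequence.
    rw [← closure_closure]
    refine mem_closure_of_tendsto (tendsto_pi_nhds.2 fun j => hlim (Φ θ (z j)))
      (Eventually.of_forall fun k => ?_)
    have hc : Continuous fun (θ : Θ) (j : Fin m) => u k (Φ θ (z j)) :=
      continuous_pi fun j => (hcont _ (hsub (hu k))).comp (hΦ (z j))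
    refine map_mem_closure hc (TopologicalSpace.denseRange_denseSeq Θ θ) ?_
    rintro _ ⟨k', rfl⟩
    exact ⟨(⟨u k, hu k⟩, k'), rfl⟩

end Separable

/-- Selects the admissible pairs (e, ℓ): (0, the right derivative of F at the end of the window)
always, and (1, L (β - α)) when the right derivative is L-Lipschitz. -/
theorem le_two_mul_kTerm {Y : Type*} [MeasurableSpace Y] {a : ℝ} {b : EReal} {f : ℝ → ℝ}
    (hf : IsF1 a b f) {α β w : ℝ} (hαβ : α < β) (hw : zZero f + (β - α) < w)
    (hfin : legendre a b f w < ⊤) {L : ℝ≥0} {Ψ : Set (Y → ℝ)} {P : Measure Y} {n : ℕ}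
    (hR : 0 ≤ rademacher Ψ P n) {t : ℝ}
    (ht : ∀ e ℓ : ℝ, 0 ≤ e → 0 ≤ ℓ →
      (∀ x ∈ Icc (zZero f - (β - α)) (zZero f + (β - α)),
        ∀ y ∈ Icc (zZero f - (β - α)) (zZero f + (β - α)),
        |(conj a b f x - e * x) - (conj a b f y - e * y)| ≤ ℓ * |x - y|) →
      t ≤ 2 * ((e + ℓ) * rademacher Ψ P n + ℓ * ((β - α) / 2 / √(n : ℝ)))) :
    t ≤ 2 * kTerm a b f α β L Ψ P n := by
  have hF := hf.isConjugate hfin (by linarith)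
  have hD := hF.one_le_rightDeriv (x := zZero f + (β - α)) (by linarith) hw
  have e1 : legendreRightDeriv a b f (β - α + zZero f) =
      rightDeriv (conj a b f) (zZero f + (β - α)) := by rw [add_comm]; rfl
  have h2 : t ≤ 2 * (legendreRightDeriv a b f (β - α + zZero f) *
      (rademacher Ψ P n + (β - α) / (2 * √(n : ℝ)))) := by
    rw [e1]
    refine (ht 0 (rightDeriv (conj a b f) (zZero f + (β - α))) le_rfl (by linarith)
      fun x hx y hy => ?_).trans (le_of_eq ?_)
    · simpa using hF.abs_sub_le hw hx.2 hy.2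
    · rw [div_div]
      ring
  unfold kTerm
  split_ifs with hL
  · rw [mul_min_of_nonneg _ _ zero_le_two]
    refine le_min ?_ h2
    have hL' : LipschitzOnWith L (rightDeriv (conj a b f))
        (Icc (zZero f - (β - α)) (zZero f + (β - α))) := by
      rw [← add_sub_assoc]
      exact hL.1
    have hB : 0 < β - α := by linarith
    refine (ht 1 (L * (β - α)) zero_le_one (by positivity) fun x hx y hy => ?_).trans ?_
    · simpa using hF.abs_sub_id_sub_le hB hw hL' hx hy
    -- The pair (1, L (β - α)) gives coefficient 1 + (β - α) L in front of the complexity;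
    -- nonnegativity of the complexity relaxes it to the stated 1 + 2 (β - α) L.
    · have h3 : 0 ≤ (β - α) * L * rademacher Ψ P n := by positivity
      have h4 : L * (β - α) * ((β - α) / 2 / √(n : ℝ)) =
          (β - α) ^ 2 * L / (2 * √(n : ℝ)) := by
        rw [div_div]
        ring
      rw [h4]
      linarith
  · exact h2

/-- Extends a bound from the countable family to all of Γ' × Θ: continuity in θ for each
approximating function, then a pointwise limit in h. Joint continuity is not needed. -/
theorem le_of_forall_countable_le {X Θ : Type*} [TopologicalSpace Θ]
    [TopologicalSpace.SeparableSpace Θ] [Nonempty Θ] {Γt Γ₀ : Set (X → ℝ)} (hsub : Γ₀ ⊆ Γt)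
    (hlim : ∀ h ∈ Γt, ∃ u : ℕ → X → ℝ,
      (∀ j, u j ∈ Γ₀) ∧ ∀ x, Tendsto (fun j => u j x) atTop (𝓝 (h x)))
    {J : (X → ℝ) → Θ → ℝ} {s : ℝ} (hJθ : ∀ h ∈ Γt, Continuous (J h))
    (hJh : ∀ θ, ∀ h ∈ Γt, ∀ u : ℕ → X → ℝ, (∀ j, u j ∈ Γt) →
      (∀ x, Tendsto (fun j => u j x) atTop (𝓝 (h x))) →
      Tendsto (fun j => J (u j) θ) atTop (𝓝 (J h θ)))
    (hle : ∀ q : Γ₀ × ℕ, J q.1 (TopologicalSpace.denseSeq Θ q.2) ≤ s) {h : X → ℝ} (hh : h ∈ Γt)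
    (θ : Θ) : J h θ ≤ s := by
  obtain ⟨u, hu, hul⟩ := hlim h hh
  refine le_of_tendsto' (hJh θ h hh u (fun j => hsub (hu j)) hul) fun j => ?_
  have hcl : IsClosed {θ | J (u j) θ ≤ s} := isClosed_le (hJθ _ (hsub (hu j))) continuous_const
  refine hcl.closure_subset_iff.2 ?_ (TopologicalSpace.denseRange_denseSeq Θ θ)
  rintro _ ⟨k, rfl⟩
  exact hle (⟨u j, hu j⟩, k)

theorem le_delta_div {a : ℝ} {b : EReal} {f : ℝ → ℝ} {α β : ℝ} (hαβ : α < β) {n : ℕ} (hn : 0 < n)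
    {d : ℝ} (hd : ∀ z ∈ Icc (zZero f - (β - α)) (zZero f),
      d ≤ -z + ((n : ℝ) - 1) / n * conj a b f z + 1 / (n : ℝ) * conj a b f (β - α + z)) :
    d ≤ delta a b f α β n / n := by
  have hn' : (0 : ℝ) < n := by exact_mod_cast hn
  have : Nonempty (Icc (zZero f - (β - α)) (zZero f)) := ⟨⟨zZero f, by simp [hαβ.le]⟩⟩
  rw [le_div_iff₀ hn', mul_comm]
  exact le_ciInf fun z => mul_le_mul_of_nonneg_left (hd z z.2) hn'.le

/-- Monotonicity of the outer measure, so neither event has to be measurable. -/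
theorem measureReal_le_of_ae_imp {Ω : Type*} [MeasurableSpace Ω] {μ : Measure Ω}
    [IsFiniteMeasure μ] {p q : Ω → Prop} (h : ∀ᵐ ω ∂μ, p ω → q ω) :
    μ.real {ω | p ω} ≤ μ.real {ω | q ω} :=
  ENNReal.toReal_mono (measure_ne_top _ _) (measure_mono_ae h)

end FGammaGAN

/-! ### The concentration inequalities -/

open FGammaGAN
theorem mainTheorem6
    {X Z Θ Ω : Type*}
    [TopologicalSpace X] [MeasurableSpace X] [BorelSpace X]
    [MeasurableSpace Z]
    [MetricSpace Θ] [TopologicalSpace.SeparableSpace Θ] [MeasurableSpace Θ] [BorelSpace Θ]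
    [MeasurableSpace Ω] (μ : Measure Ω) [IsProbabilityMeasure μ]
    -- the function `f` and the bounds `α < β`
    (a : ℝ) (b : EReal) (f : ℝ → ℝ) (hf : IsF1 a b f)
    (hf_strict : ∃ U ∈ 𝓝 (1 : ℝ), StrictConvexOn ℝ U f)
    (α β : ℝ) (hαβ : α < β)
    (hz : zZero f + β - α ∈ interior {z : ℝ | legendre a b f z < ⊤})
    -- the discriminator spaces
    (Γ Γt : Set (X → ℝ)) (hΓt_nonempty : Γt.Nonempty) (hΓt_sub : Γt ⊆ Γ)
    (hΓ_cont : ∀ h ∈ Γ, Continuous h) (hΓ_bdd : ∀ h ∈ Γ, ∀ x, α ≤ h x ∧ h x ≤ β)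
    (hΓ_sep : PointwiseSeparable Γ) (hΓt_sep : PointwiseSeparable Γt)
    -- the noise source and the generators
    (PZ : Measure Z) [IsProbabilityMeasure PZ]
    (Φ : Θ → Z → X) (hΦ_meas : ∀ θ, Measurable (Φ θ))
    (hΦ_cont : ∀ z, Continuous fun θ => Φ θ z)
    -- the data distribution and the samples
    (Q : Measure X) [IsProbabilityMeasure Q]
    (n m : ℕ) (hn : 0 < n) (hm : 0 < m)
    (xs : Fin n → Ω → X) (zs : Fin m → Ω → Z)
    (hxs_meas : ∀ i, Measurable (xs i)) (hzs_meas : ∀ j, Measurable (zs j))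
    (hxs_law : ∀ i, Measure.map (xs i) μ = Q) (hzs_law : ∀ j, Measure.map (zs j) μ = PZ)
    (hxs_indep : iIndepFun xs μ) (hzs_indep : iIndepFun zs μ)
    (hxz_indep : IndepFun (fun ω i => xs i ω) (fun ω j => zs j ω) μ)
    -- the approximate optimizer of the empirical problem
    (εopt : ℝ) (hεopt : 0 ≤ εopt)
    (θopt : Ω → Θ) (hθopt_meas : Measurable θopt)
    (hθopt : ∀ᵐ ω ∂μ,
      divergence a b f Γt (empirical fun j => Φ (θopt ω) (zs j ω)) (empirical fun i => xs i ω) ≤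
        (⨅ θ, divergence a b f Γt (empirical fun j => Φ θ (zs j ω)) (empirical fun i => xs i ω))
          + (εopt : EReal))
    -- the Lipschitz constant entering the definition of `kTerm`
    (L : ℝ≥0) (ε : ℝ) (hε : 0 < ε) :
    μ.real {ω | ((ε + approxError a b f α β Γ Γt + εopt + 4 * rademacher (compFamily Γt Φ) PZ m
              + 4 * kTerm a b f α β L Γt Q n : ℝ) : EReal) ≤
            divergence a b f Γ (PZ.map (Φ (θopt ω))) Q
              - ⨅ θ, divergence a b f Γ (PZ.map (Φ θ)) Q}
        ≤ Real.exp (-(ε ^ 2 / (2 / m * (β - α) ^ 2 + 2 / n * delta a b f α β n ^ 2))) ∧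
    ((∀ x : Fin n → X, ⨅ θ, divergence a b f Γt (PZ.map (Φ θ)) (empirical x) = 0) →
      μ.real {ω | ((ε + approxError a b f α β Γ Γt + εopt + 4 * rademacher (compFamily Γt Φ) PZ m
              + 2 * kTerm a b f α β L Γt Q n : ℝ) : EReal) ≤
            divergence a b f Γ (PZ.map (Φ (θopt ω))) Q}
        ≤ Real.exp (-(ε ^ 2 / (2 / m * (β - α) ^ 2 + 1 / (2 * n) * delta a b f α β n ^ 2)))) := by
  -- A point strictly beyond z₀ + β - α where f^* is still finite keeps the whole window in the
  -- interior of the domain, where right derivatives behave well.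
  obtain ⟨w, hwfin, hw⟩ : ∃ w, legendre a b f w < ⊤ ∧ zZero f + (β - α) < w := by
    have h1 : ∀ᶠ y in 𝓝 (zZero f + β - α), legendre a b f y < ⊤ := mem_interior_iff_mem_nhds.1 hz
    have h2 : ∀ᶠ y in 𝓝[>] (zZero f + β - α), legendre a b f y < ⊤ := nhdsWithin_le_nhds h1
    obtain ⟨w, h3, h4⟩ := (h2.and self_mem_nhdsWithin).exists
    exact ⟨w, h3, by rw [← add_sub_assoc]; exact h4⟩
  have hF := hf.isConjugate hwfin (by linarith)
  have hne : Γ.Nonempty := hΓt_nonempty.mono hΓt_sub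
  have hΓm : ∀ h ∈ Γ, Measurable h := fun h hh => (hΓ_cont h hh).measurable
  have htm : ∀ h ∈ Γt, Measurable h := fun h hh => hΓm h (hΓt_sub hh)
  have htb : ∀ h ∈ Γt, ∀ x, α ≤ h x ∧ h x ≤ β := fun h hh => hΓ_bdd h (hΓt_sub hh)
  have htc : ∀ h ∈ Γt, Continuous h := fun h hh => hΓ_cont h (hΓt_sub hh)
  obtain ⟨ω₀⟩ : Nonempty Ω := nonempty_of_isProbabilityMeasure μ
  have hΘ : Nonempty Θ := ⟨θopt ω₀⟩
  have hPθ : ∀ θ, IsProbabilityMeasure (PZ.map (Φ θ)) := fun θ =>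
    Measure.isProbabilityMeasure_map (hΦ_meas θ).aemeasurable
  obtain ⟨Γ₀, hsub, hcount, hlim⟩ := hΓt_sep
  have hne₀ : Γ₀.Nonempty := by
    obtain ⟨h, hh⟩ := hΓt_nonempty
    obtain ⟨u, hu, -⟩ := hlim h hh
    exact ⟨u 0, hu 0⟩
  have := hne₀.to_subtype
  have := hcount.to_subtype
  have hn' : (0 : ℝ) < n := by exact_mod_cast hn
  have hm' : (0 : ℝ) < m := by exact_mod_cast hm
  set z₀ := zZero f
  set F := conj a b f
  -- the deviations of the empirical cumulants
  let T₁ : (Fin n → X) → ℝ := fun x =>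
    ⨆ h : Γ₀, (cumul F z₀ α β (empirical x) h - cumul F z₀ α β Q h)
  let T₂ : (Fin n → X) → ℝ := fun x =>
    ⨆ h : Γ₀, (cumul F z₀ α β Q h - cumul F z₀ α β (empirical x) h)
  have hHm : ∀ h : Γ₀, Measurable (h : X → ℝ) := fun h => htm h (hsub h.2)
  have hHb : ∀ (h : Γ₀) x, α ≤ (h : X → ℝ) x ∧ (h : X → ℝ) x ≤ β := fun h => htb h (hsub h.2)
  obtain ⟨hT₁, hT₂⟩ : HasBoundedDiff T₁ (delta a b f α β n / n) ∧
      HasBoundedDiff T₂ (delta a b f α β n / n) :=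
    hF.hasBoundedDiff_cumul (Q := Q) hαβ hw hHm hHb hn fun d hd => le_delta_div hαβ hn hd
  have hC0 : 0 ≤ max |α| |β| := (abs_nonneg _).trans (le_max_left _ _)
  have hRQ := rademacher_eq_integral_signAvg (Q := Q) (n := n) hΓt_nonempty hne₀ htb hsub hlim
  have hRQ0 : 0 ≤ rademacher Γt Q n := by
    rw [hRQ]
    exact integral_nonneg fun x => signAvg_nonneg hC0 fun h j =>
      abs_le_max_abs_abs (hHb h _).1 (hHb h _).2
  have hET₁ : ∫ x, T₁ x ∂(Measure.pi fun _ => Q) ≤ 2 * kTerm a b f α β L Γt Q n :=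
    le_two_mul_kTerm hf hαβ hw hwfin hRQ0 fun e ℓ he hℓ hφ => by
      rw [hRQ]
      exact (hF.integral_ciSup_cumul_sub_le hαβ hw hHm hHb hn he hℓ hφ).1
  have hET₂ : ∫ x, T₂ x ∂(Measure.pi fun _ => Q) ≤ 2 * kTerm a b f α β L Γt Q n :=
    le_two_mul_kTerm hf hαβ hw hwfin hRQ0 fun e ℓ he hℓ hφ => by
      rw [hRQ]
      exact (hF.integral_ciSup_cumul_sub_le hαβ hw hHm hHb hn he hℓ hφ).2
  -- the deviations of the empirical means
  let G : Γ₀ × ℕ → Z → ℝ := fun q z => (q.1 : X → ℝ) (Φ (TopologicalSpace.denseSeq Θ q.2) z)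
  have hGm : ∀ q, Measurable (G q) := fun q => (hHm q.1).comp (hΦ_meas _)
  have hGb : ∀ q z, α ≤ G q z ∧ G q z ≤ β := fun q z => hHb q.1 _
  have hGabs : ∀ q z, |G q z| ≤ max |α| |β| := fun q z =>
    abs_le_max_abs_abs (hGb q z).1 (hGb q z).2
  let S₁ : (Fin m → Z) → ℝ := fun z => ⨆ q, (∫ y, G q y ∂PZ - (1 / (m : ℝ)) * ∑ j, G q (z j))
  let S₂ : (Fin m → Z) → ℝ := fun z => ⨆ q, ((1 / (m : ℝ)) * ∑ j, G q (z j) - ∫ y, G q y ∂PZ)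
  obtain ⟨hS₂, hS₁⟩ : HasBoundedDiff S₂ ((β - α) / m) ∧ HasBoundedDiff S₁ ((β - α) / m) :=
    hasBoundedDiff_mean (P := PZ) hGm hGb
  have hRZ := rademacher_compFamily_eq_integral_signAvg (PZ := PZ) (m := m) hΦ_cont hΓt_nonempty
    hne₀ htc htb hsub hlim
  have hES₁ : ∫ z, S₁ z ∂(Measure.pi fun _ => PZ) ≤ 2 * rademacher (compFamily Γt Φ) PZ m := by
    rw [hRZ]
    exact integral_ciSup_sub_avg_le hm hGm hGabs
  have hES₂ : ∫ z, S₂ z ∂(Measure.pi fun _ => PZ) ≤ 2 * rademacher (compFamily Γt Φ) PZ m := by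
    rw [hRZ]
    exact integral_ciSup_avg_sub_le hm hGm hGabs
  -- the deviations bound the differences of the divergences
  have hT₁le : ∀ (x : Fin n → X), ∀ h ∈ Γt,
      cumul F z₀ α β (empirical x) h - cumul F z₀ α β Q h ≤ T₁ x := fun x h hh => by
    have := isProbabilityMeasure_empirical hn x
    obtain ⟨u, hu, hul⟩ := hlim h hh
    have ht : ∀ (M : Measure X) [IsProbabilityMeasure M],
        Tendsto (fun j => cumul F z₀ α β M (u j)) atTop (𝓝 (cumul F z₀ α β M h)) := fun M _ =>
      hF.tendsto_cumul hαβ hw (fun j => htm _ (hsub (hu j))) (fun j => htb _ (hsub (hu j)))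
        (htm h hh) (htb h hh) hul
    refine le_of_tendsto' ((ht (empirical x)).sub (ht Q)) fun j => ?_
    refine le_ciSup (f := fun h : Γ₀ => cumul F z₀ α β (empirical x) h - cumul F z₀ α β Q h)
      ⟨β - α, ?_⟩ ⟨u j, hu j⟩
    rintro _ ⟨h, rfl⟩
    linarith [(hF.cumul_mem_Icc (P := empirical x) hαβ hw (hHm h) (hHb h)).2,
      (hF.cumul_mem_Icc (P := Q) hαβ hw (hHm h) (hHb h)).1]
  have hT₂le : ∀ (x : Fin n → X), ∀ h ∈ Γt,
      cumul F z₀ α β Q h - cumul F z₀ α β (empirical x) h ≤ T₂ x := fun x h hh => by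
    have := isProbabilityMeasure_empirical hn x
    obtain ⟨u, hu, hul⟩ := hlim h hh
    have ht : ∀ (M : Measure X) [IsProbabilityMeasure M],
        Tendsto (fun j => cumul F z₀ α β M (u j)) atTop (𝓝 (cumul F z₀ α β M h)) := fun M _ =>
      hF.tendsto_cumul hαβ hw (fun j => htm _ (hsub (hu j))) (fun j => htb _ (hsub (hu j)))
        (htm h hh) (htb h hh) hul
    refine le_of_tendsto' ((ht Q).sub (ht (empirical x))) fun j => ?_
    refine le_ciSup (f := fun h : Γ₀ => cumul F z₀ α β Q h - cumul F z₀ α β (empirical x) h)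
      ⟨β - α, ?_⟩ ⟨u j, hu j⟩
    rintro _ ⟨h, rfl⟩
    linarith [(hF.cumul_mem_Icc (P := empirical x) hαβ hw (hHm h) (hHb h)).1,
      (hF.cumul_mem_Icc (P := Q) hαβ hw (hHm h) (hHb h)).2]
  have hIcont : ∀ h ∈ Γt, Continuous fun θ => ∫ y, h (Φ θ y) ∂PZ := fun h hh =>
    continuous_of_dominated (bound := fun _ => max |α| |β|)
      (fun θ => ((htm h hh).comp (hΦ_meas θ)).aestronglyMeasurable)
      (fun θ => ae_of_all _ fun y => abs_le_max_abs_abs (htb h hh _).1 (htb h hh _).2)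
      (integrable_const _) (ae_of_all _ fun y => (htc h hh).comp (hΦ_cont y))
  have hAcont : ∀ h ∈ Γt, ∀ z : Fin m → Z, Continuous fun θ => (1 / (m : ℝ)) * ∑ j, h (Φ θ (z j)) :=
    fun h hh z => continuous_const.mul
      (continuous_finsetSum _ fun j _ => (htc h hh).comp (hΦ_cont (z j)))
  have hIlim : ∀ θ, ∀ h ∈ Γt, ∀ u : ℕ → X → ℝ, (∀ j, u j ∈ Γt) →
      (∀ x, Tendsto (fun j => u j x) atTop (𝓝 (h x))) →
      Tendsto (fun j => ∫ y, u j (Φ θ y) ∂PZ) atTop (𝓝 (∫ y, h (Φ θ y) ∂PZ)) :=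
    fun θ h hh u hu hul => tendsto_integral_of_bdd (α := α) (β := β)
      (u := fun j y => u j (Φ θ y)) (fun j => (htm _ (hu j)).comp (hΦ_meas θ))
      (fun j y => htb _ (hu j) _) fun y => hul _
  have hAlim : ∀ θ (z : Fin m → Z), ∀ h ∈ Γt, ∀ u : ℕ → X → ℝ, (∀ j, u j ∈ Γt) →
      (∀ x, Tendsto (fun j => u j x) atTop (𝓝 (h x))) →
      Tendsto (fun k => (1 / (m : ℝ)) * ∑ j, u k (Φ θ (z j))) atTop
        (𝓝 ((1 / (m : ℝ)) * ∑ j, h (Φ θ (z j)))) :=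
    fun θ z h hh u hu hul => (tendsto_finsetSum _ fun j _ => hul _).const_mul _
  have hmean : ∀ (z : Fin m → Z) q, |(1 / (m : ℝ)) * ∑ j, G q (z j) - ∫ y, G q y ∂PZ| ≤ β - α :=
    fun z q => by
      have := isProbabilityMeasure_empirical hm z
      rw [← integral_empirical z (hGm q), abs_le]
      have h1 := le_integral_of_bdd (P := empirical z) (hGm q) (hGb q)
      have h2 := le_integral_of_bdd (P := PZ) (hGm q) (hGb q)
      constructor <;> linarith [h1.1, h1.2, h2.1, h2.2]
  have hS₁le : ∀ (z : Fin m → Z), ∀ h ∈ Γt, ∀ θ,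
      ∫ y, h (Φ θ y) ∂PZ - (1 / (m : ℝ)) * ∑ j, h (Φ θ (z j)) ≤ S₁ z := fun z h hh θ =>
    le_of_forall_countable_le hsub hlim
      (J := fun h θ => ∫ y, h (Φ θ y) ∂PZ - (1 / (m : ℝ)) * ∑ j, h (Φ θ (z j)))
      (fun h hh => (hIcont h hh).sub (hAcont h hh z))
      (fun θ h hh u hu hul => (hIlim θ h hh u hu hul).sub (hAlim θ z h hh u hu hul))
      (fun q => le_ciSup (f := fun q => ∫ y, G q y ∂PZ - (1 / (m : ℝ)) * ∑ j, G q (z j))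
        (bddAbove_range_of_abs_le fun q => by rw [abs_sub_comm]; exact hmean z q) q) hh θ
  have hS₂le : ∀ (z : Fin m → Z), ∀ h ∈ Γt, ∀ θ,
      (1 / (m : ℝ)) * ∑ j, h (Φ θ (z j)) - ∫ y, h (Φ θ y) ∂PZ ≤ S₂ z := fun z h hh θ =>
    le_of_forall_countable_le hsub hlim
      (J := fun h θ => (1 / (m : ℝ)) * ∑ j, h (Φ θ (z j)) - ∫ y, h (Φ θ y) ∂PZ)
      (fun h hh => (hAcont h hh z).sub (hIcont h hh))
      (fun θ h hh u hu hul => (hAlim θ z h hh u hu hul).sub (hIlim θ h hh u hu hul))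
      (fun q => le_ciSup (f := fun q => (1 / (m : ℝ)) * ∑ j, G q (z j) - ∫ y, G q y ∂PZ)
        (bddAbove_range_of_abs_le (hmean z)) q) hh θ
  have hmap : ∀ θ, ∀ h ∈ Γt, ∫ x, h x ∂(PZ.map (Φ θ)) = ∫ y, h (Φ θ y) ∂PZ := fun θ h hh =>
    integral_map (hΦ_meas θ).aemeasurable (htm h hh).aestronglyMeasurable
  let Dt : Measure X → Measure X → ℝ := realDiv F z₀ α β Γt
  let DΓ : Measure X → Measure X → ℝ := realDiv F z₀ α β Γ
  have hDt_abs : ∀ (M M' : Measure X) [IsProbabilityMeasure M] [IsProbabilityMeasure M'],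
      |Dt M M'| ≤ β - α := fun M M' _ _ => hF.abs_realDiv_le hαβ hw htm htb hΓt_nonempty
  have hDΓ_abs : ∀ (M M' : Measure X) [IsProbabilityMeasure M] [IsProbabilityMeasure M'],
      |DΓ M M'| ≤ β - α := fun M M' _ _ => hF.abs_realDiv_le hαβ hw hΓm hΓ_bdd hne
  have hbelow : ∀ {u : Θ → ℝ}, (∀ θ, |u θ| ≤ β - α) → BddBelow (range u) := fun hu =>
    ⟨-(β - α), by rintro _ ⟨θ, rfl⟩; exact (abs_le.1 (hu θ)).1⟩
  have := hΓt_nonempty.to_subtype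
  have hgap : ∀ (M M' : Measure X) [IsProbabilityMeasure M] [IsProbabilityMeasure M'], ∀ h ∈ Γt,
      ∫ x, h x ∂M - cumul F z₀ α β M' h ≤ Dt M M' := fun M M' _ _ h hh =>
    hF.gap_le_realDiv hαβ hw htm htb hh
  -- The objective is a mean minus a cumulant, so passing to empirical measures costs the
  -- true-minus-empirical mean and the empirical-minus-true cumulant.
  have hD₁ : ∀ θ (x : Fin n → X) (z : Fin m → Z), Dt (PZ.map (Φ θ)) Q ≤
      Dt (empirical fun j => Φ θ (z j)) (empirical x) + S₁ z + T₁ x := fun θ x z => by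
    have := isProbabilityMeasure_empirical hn x
    have := isProbabilityMeasure_empirical hm fun j => Φ θ (z j)
    refine ciSup_le fun h => ?_
    have h1 := hgap (empirical fun j => Φ θ (z j)) (empirical x) h h.2
    have h2 := hS₁le z h h.2 θ
    have h3 := hT₁le x h h.2
    rw [integral_empirical _ (htm h h.2)] at h1
    rw [gap, hmap θ h h.2]
    linarith
  have hD₂ : ∀ θ (x : Fin n → X) (z : Fin m → Z),
      Dt (empirical fun j => Φ θ (z j)) (empirical x) ≤
        Dt (PZ.map (Φ θ)) (empirical x) + S₂ z := fun θ x z => by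
    have := isProbabilityMeasure_empirical hn x
    refine ciSup_le fun h => ?_
    have h1 := hgap (PZ.map (Φ θ)) (empirical x) h h.2
    have h2 := hS₂le z h h.2 θ
    rw [hmap θ h h.2] at h1
    rw [gap, integral_empirical _ (htm h h.2)]
    linarith
  have hD₃ : ∀ θ (x : Fin n → X),
      Dt (PZ.map (Φ θ)) (empirical x) ≤ Dt (PZ.map (Φ θ)) Q + T₂ x := fun θ x => by
    refine ciSup_le fun h => ?_
    have h1 := hgap (PZ.map (Φ θ)) Q h h.2
    have h3 := hT₂le x h h.2
    rw [gap]
    linarith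
  have happ : ∀ θ, DΓ (PZ.map (Φ θ)) Q ≤ Dt (PZ.map (Φ θ)) Q + approxError a b f α β Γ Γt :=
    fun θ => by
      have := hF.realDiv_le_add_approx (P := PZ.map (Φ θ)) (Q := Q) hαβ hw hΓm hΓ_bdd
        hΓt_nonempty hΓt_sub
      rw [← add_sub_assoc] at this
      exact this
  have hDmono : ∀ θ, Dt (PZ.map (Φ θ)) Q ≤ DΓ (PZ.map (Φ θ)) Q := fun θ =>
    hF.realDiv_mono hαβ hw hΓm hΓ_bdd hΓt_nonempty hΓt_sub
  have hdivΓ : ∀ θ, divergence a b f Γ (PZ.map (Φ θ)) Q = (DΓ (PZ.map (Φ θ)) Q : ℝ) := fun θ =>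
    hf.divergence_eq hαβ hw hwfin hΓm hΓ_bdd hne
  have hdivt : ∀ (M M' : Measure X) [IsProbabilityMeasure M] [IsProbabilityMeasure M'],
      divergence a b f Γt M M' = (Dt M M' : ℝ) := fun M M' _ _ =>
    hf.divergence_eq hαβ hw hwfin htm htb hΓt_nonempty
  have hopt : ∀ᵐ ω ∂μ, ∀ θ,
      Dt (empirical fun j => Φ (θopt ω) (zs j ω)) (empirical fun i => xs i ω) ≤
        Dt (empirical fun j => Φ θ (zs j ω)) (empirical fun i => xs i ω) + εopt := by
    filter_upwards [hθopt] with ω hω θ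
    have := isProbabilityMeasure_empirical hn fun i => xs i ω
    have := fun θ => isProbabilityMeasure_empirical hm fun j => Φ θ (zs j ω)
    have h1 := hω.trans (add_le_add_left (iInf_le _ θ) _)
    rw [hdivt, hdivt] at h1
    exact_mod_cast h1
  have hkey : ∀ᵐ ω ∂μ, ∀ θ, DΓ (PZ.map (Φ (θopt ω))) Q ≤ approxError a b f α β Γ Γt + εopt +
      S₁ (fun j => zs j ω) + S₂ (fun j => zs j ω) + T₁ (fun i => xs i ω) +
        Dt (PZ.map (Φ θ)) (empirical fun i => xs i ω) := by
    filter_upwards [hopt] with ω hω θ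
    have h1 := happ (θopt ω)
    have h2 := hD₁ (θopt ω) (fun i => xs i ω) fun j => zs j ω
    have h3 := hω θ
    have h4 := hD₂ θ (fun i => xs i ω) fun j => zs j ω
    linarith
  -- The Z-part alone keeps the variance proxy positive, whatever the value of Δ.
  have hV : ∀ c : ℝ, 0 < n * c ^ 2 + m * ((β - α) / m + (β - α) / m) ^ 2 := fun c => by
    have : 0 < (β - α) / m := div_pos (by linarith) hm'
    positivity
  constructor
  · refine (measureReal_le_of_ae_imp ?_).trans
      ((measureReal_ge_le_of_hasBoundedDiff hxs_meas hzs_meas hxs_law hzs_law hxs_indep hzs_indep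
        hxz_indep (hT₁.add hT₂) (hS₁.add hS₂) rfl (hV _) hε).trans (le_of_eq ?_))
    · filter_upwards [hkey] with ω hω hle
      simp only [hdivΓ] at hle
      rw [coe_ciInf_eq (hbelow fun θ => hDΓ_abs _ _), ← EReal.coe_sub, EReal.coe_le_coe_iff] at hle
      have h1 : DΓ (PZ.map (Φ (θopt ω))) Q - (approxError a b f α β Γ Γt + εopt +
          S₁ (fun j => zs j ω) + S₂ (fun j => zs j ω) + T₁ (fun i => xs i ω) +
          T₂ (fun i => xs i ω)) ≤ ⨅ θ, DΓ (PZ.map (Φ θ)) Q := by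
        refine le_ciInf fun θ => ?_
        linarith [hω θ, hD₃ θ fun i => xs i ω, hDmono θ]
      rw [integral_add (hT₁.integrable _) (hT₂.integrable _),
        integral_add (hS₁.integrable _) (hS₂.integrable _)]
      linarith
    -- The difference constants are 2Δ/n and 2(β - α)/m, so V = 4Δ²/n + 4(β - α)²/m, and 2 ε² / V is
    -- the stated exponent.
    · congr 2
      field_simp
      ring
  · intro hzero
    refine (measureReal_le_of_ae_imp ?_).trans
      ((measureReal_ge_le_of_hasBoundedDiff hxs_meas hzs_meas hxs_law hzs_law hxs_indep hzs_indep
        hxz_indep hT₁ (hS₁.add hS₂) rfl (hV _) hε).trans (le_of_eq ?_))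
    · filter_upwards [hkey] with ω hω hle
      rw [hdivΓ, EReal.coe_le_coe_iff] at hle
      have := isProbabilityMeasure_empirical hn fun i => xs i ω
      have h0 : ⨅ θ, Dt (PZ.map (Φ θ)) (empirical fun i => xs i ω) = 0 := by
        have h1 := hzero fun i => xs i ω
        simp only [hdivt] at h1
        rw [coe_ciInf_eq (hbelow fun θ => hDt_abs _ _)] at h1
        exact_mod_cast h1
      have h1 : DΓ (PZ.map (Φ (θopt ω))) Q - (approxError a b f α β Γ Γt + εopt +
          S₁ (fun j => zs j ω) + S₂ (fun j => zs j ω) + T₁ (fun i => xs i ω)) ≤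
          ⨅ θ, Dt (PZ.map (Φ θ)) (empirical fun i => xs i ω) := by
        refine le_ciInf fun θ => ?_
        linarith [hω θ]
      rw [integral_add (hS₁.integrable _) (hS₂.integrable _)]
      linarith
    -- Here T₁ alone has constant Δ/n, which replaces 4Δ²/n in V by Δ²/n.
    · congr 2
      field_simp
      ring
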